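/- Let $(\Sigma,g)$ be a compact connected smooth Riemannian surface without boundary (orientable or not) with total area $\int_\Sigma 1\,dV_g=1$, and let $d$ be its Riemannian distance. Let $h_1,h_2:\Sigma\to(0,\infty)$ be $C^1$ functions and let $\rho=(\rho_1,\rho_2)$ with $\rho_1,\rho_2>4\pi$. For $u_1,u_2\in H^1(\Sigma)$ put $$J_\rho(u_1,u_2)=\int_\Sigma \tfrac13\left(|\nabla u_1|^2+|\nabla u_2|^2+\nabla u_1\cdot\nabla u_2\right)dV_g+\sum_{i=1}^2\rho_i\left(\int_\Sigma u_i\,dV_g-\log\int_\Sigma h_ie^{u_i}\,dV_g\right).$$ Fix $\delta>0$. Let $\overline\Sigma_\delta$ be the cone obtained from $\Sigma\times(0,\infty)$ by collapsing $\Sigma\times[\delta,\infty)$ to one point, and let $X=(\overline\Sigma_\delta\times\overline\Sigma_\delta)\setminus\{(\vartheta,\vartheta)\}$ be the complement of the diagonal. For $\nu>0$ let $\mathcal X_\nu=\mathcal X_{\nu,1}\cup\mathcal X_{\nu,2}\subseteq X$, where $$\mathcal X_{\nu,1}=\left\{((x_1,t_1),(x_2,t_2))\in X:\ |t_1-t_2|^2+d(x_1,x_2)^2\ge\delta^4,\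 \max\{t_1,t_2\}<\delta,\ \min\{t_1,t_2\}\in[\nu^2,\nu]\right\},$$ $$\mathcal X_{\nu,2}=\left\{((x_1,t_1),(x_2,t_2))\in X:\ \max\{t_1,t_2\}=\delta,\ \min\{t_1,t_2\}\in[\nu^2,\nu]\right\}.$$ For $(\vartheta_1,\vartheta_2)=((x_1,t_1),(x_2,t_2))\in\mathcal X_\nu$ (with $t_1,t_2\le\delta$) let $\varphi_{(\vartheta_1,\vartheta_2)}=(\varphi_1,\varphi_2)$ with $$\varphi_1(y)=\log\frac{1+\tilde t_2^2\,d(x_2,y)^2}{\left(1+\tilde t_1^2\,d(x_1,y)^2\right)^2},\qquad \varphi_2(y)=\log\frac{1+\tilde t_1^2\,d(x_1,y)^2}{\left(1+\tilde t_2^2\,d(x_2,y)^2\right)^2},$$ where $\tilde t_i=1/t_i$ if $t_i\le\delta/2$ and $\tilde t_i=-\frac4{\delta^2}(t_i-\delta)$ if $t_i\ge\delta/2$; this does not depend on the representatives since $\tilde t_i=0$ for $t_i=\delta$. Then $\varphi_1,\varphi_2\in H^1(\Sigma)$ for all $\nu>0$ and $(\vartheta_1,\vartheta_2)\in\mathcal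 X_\nu$, and $$J_\rho(\varphi_{(\vartheta_1,\vartheta_2)})\to-\infty\quad\text{as }\nu\to0,\ \text{uniformly for }(\vartheta_1,\vartheta_2)\in\mathcal X_\nu,$$ that is, for every $L\in\mathbb R$ there is $\nu_0>0$ such that $J_\rho(\varphi_{(\vartheta_1,\vartheta_2)})\le -L$ for all $0<\nu<\nu_0$ and all $(\vartheta_1,\vartheta_2)\in\mathcal X_\nu$. -/

import Mathlib

open MeasureTheory Set Filter Topology Manifold Bundle
open scoped ContDiff

noncomputable section

namespace Toda

/-- The coordinate plane `ℝ²`, with its Euclidean norm and Lebesgue measure. -/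
abbrev Plane : Type := EuclideanSpace ℝ (Fin 2)

/-! ### Riemannian volume, weak gradients and `H¹` on a surface -/

section Surface

variable {M : Type*} [MetricSpace M] [ChartedSpace Plane M]

/-- For a chart `e`, a point `z` of its target and `v ∈ ℝ²`: the coordinate vector
`v¹ ∂₁ + v² ∂₂` at the point `e⁻¹ z` of the surface. -/
def coordVec (e : OpenPartialHomeomorph M Plane) (z v : Plane) : TangentSpace (𝓡 2) (e.symm z) :=
  mfderiv 𝓘(ℝ, Plane) (𝓡 2) e.symm z v

variable [RiemannianBundle (fun x : M ↦ TangentSpace (𝓡 2) x)]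

/-- The matrix `(g_{ij})` of the metric in the coordinates of the chart `e`. -/
def gram (e : OpenPartialHomeomorph M Plane) (z : Plane) : Matrix (Fin 2) (Fin 2) ℝ :=
  Matrix.of fun i j ↦ inner ℝ (coordVec e z (EuclideanSpace.single i 1))
    (coordVec e z (EuclideanSpace.single j 1))

variable [MeasurableSpace M]

/-- The measure `√(det g_{ij}) dz¹ dz²` of the domain of the chart `e`, as a measure on `M` that
vanishes outside this domain. -/
def chartVolume (e : OpenPartialHomeomorph M Plane) : Measure M :=
  ((volume.restrict e.target).withDensity
    fun z ↦ ENNReal.ofReal (Real.sqrt (gram e z).det)).map e.symm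

variable (M) in
/-- The Riemannian volume measure `dV_g`. The measures `chartVolume e` agree on the overlaps of
the charts, so that their least upper bound is the measure that restricts to `chartVolume e` on
the domain of every chart `e`. -/
def riemVolume : Measure M :=
  ⨆ e ∈ atlas Plane M, chartVolume e

/-- The vector field `G` is a weak gradient of `u`: in every chart, the weak partial derivative of
`u` in the coordinate direction `v` is `⟨G, v¹ ∂₁ + v² ∂₂⟩_g`. -/
def IsWeakGradient (u : M → ℝ) (G : ∀ x : M, TangentSpace (𝓡 2) x) : Prop :=
  ∀ e ∈ atlas Plane M,
    LocallyIntegrableOn (fun z ↦ u (e.symm z)) e.target ∧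
    ∀ v : Plane,
      LocallyIntegrableOn (fun z ↦ inner ℝ (G (e.symm z)) (coordVec e z v)) e.target ∧
      ∀ η : Plane → ℝ, ContDiff ℝ ∞ η → HasCompactSupport η → tsupport η ⊆ e.target →
        ∫ z in e.target, u (e.symm z) * fderiv ℝ η z v =
          -∫ z in e.target, inner ℝ (G (e.symm z)) (coordVec e z v) * η z

/-- `u` has a square integrable weak gradient `G`. -/
def HasL2Gradient (u : M → ℝ) (G : ∀ x : M, TangentSpace (𝓡 2) x) : Prop :=
  IsWeakGradient u G ∧ MemLp (fun x ↦ ‖G x‖) 2 (riemVolume M)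

/-- The Sobolev space `H¹`. -/
def MemH1 (u : M → ℝ) : Prop :=
  MemLp u 2 (riemVolume M) ∧ ∃ G, HasL2Gradient u G

open Classical in
/-- The weak gradient `∇u`; it is unique up to null sets. (It is `0` if there is none.) -/
def grad (u : M → ℝ) : ∀ x : M, TangentSpace (𝓡 2) x :=
  if h : ∃ G, HasL2Gradient u G then h.choose else fun _ ↦ 0

/-- `Q(u₁, u₂) = (|∇u₁|² + |∇u₂|² + ∇u₁ · ∇u₂) / 3`. -/
def Q (u₁ u₂ : M → ℝ) (x : M) : ℝ :=
  1 / 3 * (‖grad u₁ x‖ ^ 2 + ‖grad u₂ x‖ ^ 2 + inner ℝ (grad u₁ x) (grad u₂ x))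

/-- The functional
`J_ρ(u₁, u₂) = ∫ Q(u₁, u₂) + ∑ᵢ ρᵢ (∫ uᵢ - log ∫ hᵢ exp uᵢ)`. -/
def J (ρ₁ ρ₂ : ℝ) (h₁ h₂ u₁ u₂ : M → ℝ) : ℝ :=
  (∫ x, Q u₁ u₂ x ∂riemVolume M) +
    (ρ₁ * ((∫ x, u₁ x ∂riemVolume M) -
        Real.log (∫ x, h₁ x * Real.exp (u₁ x) ∂riemVolume M)) +
      ρ₂ * ((∫ x, u₂ x ∂riemVolume M) -
        Real.log (∫ x, h₂ x * Real.exp (u₂ x) ∂riemVolume M)))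

end Surface

/-! ### The cone over the surface and the parameter sets -/

/-- The relation on `M × (0, ∞)` that collapses `M × [δ, ∞)` to one point. -/
def coneSetoid (M : Type*) (δ : ℝ) : Setoid (M × Ioi (0 : ℝ)) where
  r a b := a = b ∨ (δ ≤ (a.2 : ℝ) ∧ δ ≤ (b.2 : ℝ))
  iseqv :=
    { refl := fun _ ↦ Or.inl rfl
      symm := by
        rintro a b (h | h)
        · exact Or.inl h.symm
        · exact Or.inr h.symm
      trans := by
        rintro a b c (rfl | h) (rfl | h')
        · exact Or.inl rfl
        · exact Or.inr h'
        · exact Or.inr h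
        · exact Or.inr ⟨h.1, h'.2⟩ }

/-- The topological cone over `M`, as a set. -/
def Cone (M : Type*) (δ : ℝ) : Type _ := Quotient (coneSetoid M δ)

/-- The class of `(x, t)` in the cone. -/
def Cone.mk {M : Type*} (δ : ℝ) (x : M) (t : Ioi (0 : ℝ)) : Cone M δ :=
  Quotient.mk (coneSetoid M δ) (x, t)

/-- The product of two cones without its diagonal. -/
def X (M : Type*) (δ : ℝ) : Set (Cone M δ × Cone M δ) := {p | p.1 ≠ p.2}

section Parameters

variable (M : Type*) [MetricSpace M]

/-- Pairs of points of the cone below the vertex that are apart, the smaller parameter lying in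
`[ν², ν]`. -/
def Xν₁ (δ ν : ℝ) : Set (Cone M δ × Cone M δ) :=
  {p | p ∈ X M δ ∧ ∃ (x₁ x₂ : M) (t₁ t₂ : Ioi (0 : ℝ)),
    p = (Cone.mk δ x₁ t₁, Cone.mk δ x₂ t₂) ∧
    δ ^ 4 ≤ |(t₁ : ℝ) - t₂| ^ 2 + dist x₁ x₂ ^ 2 ∧
    max (t₁ : ℝ) t₂ < δ ∧ min (t₁ : ℝ) t₂ ∈ Icc (ν ^ 2) ν}

/-- Pairs consisting of the vertex of the cone and of a point whose parameter lies in
`[ν², ν]`. -/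
def Xν₂ (δ ν : ℝ) : Set (Cone M δ × Cone M δ) :=
  {p | p ∈ X M δ ∧ ∃ (x₁ x₂ : M) (t₁ t₂ : Ioi (0 : ℝ)),
    p = (Cone.mk δ x₁ t₁, Cone.mk δ x₂ t₂) ∧
    max (t₁ : ℝ) t₂ = δ ∧ min (t₁ : ℝ) t₂ ∈ Icc (ν ^ 2) ν}

/-- The parameter set `𝒳_ν`. -/
def Xν (δ ν : ℝ) : Set (Cone M δ × Cone M δ) := Xν₁ M δ ν ∪ Xν₂ M δ ν

end Parameters

/-! ### The test functions -/

/-- The parameter `t̃`: it is `1 / t` for `t ≤ δ / 2` and `-(4 / δ²) (t - δ)` for `t ≥ δ / 2`. -/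
def tilde (δ t : ℝ) : ℝ := if t ≤ δ / 2 then 1 / t else -(4 / δ ^ 2) * (t - δ)

section TestFunctions

variable {M : Type*} [MetricSpace M]

/-- The function `1 + t̃² d(x, y)²` of `y`, for the point `ϑ = (x, t)` of the cone, `t ≤ δ`. At the
vertex, which is represented by `t = δ`, one has `t̃ = 0`, and the function is `1`. -/
def bump {δ : ℝ} (ϑ : Cone M δ) (y : M) : ℝ :=
  Quotient.lift (s := coneSetoid M δ)
    (fun a : M × Ioi (0 : ℝ) ↦
      if (a.2 : ℝ) < δ then 1 + tilde δ a.2 ^ 2 * dist a.1 y ^ 2 else 1)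
    (by
      rintro a b (rfl | ⟨ha, hb⟩)
      · rfl
      · simp [not_lt.2 ha, not_lt.2 hb])
    ϑ

theorem bump_mk {δ : ℝ} (hδ : 0 < δ) (x : M) (t : Ioi (0 : ℝ)) (ht : (t : ℝ) ≤ δ) (y : M) :
    bump (Cone.mk δ x t) y = 1 + tilde δ t ^ 2 * dist x y ^ 2 := by
  change (if (t : ℝ) < δ then 1 + tilde δ t ^ 2 * dist x y ^ 2 else 1) = _
  split_ifs with h
  · rfl
  · have h' : (t : ℝ) = δ := le_antisymm ht (not_lt.1 h)
    have h2 : ¬ δ ≤ δ / 2 := by linarith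
    simp [h', tilde, h2]

/-- `φ₁ = log ((1 + t̃₂² d(x₂, y)²) / (1 + t̃₁² d(x₁, y)²)²)`. -/
def φ₁ {δ : ℝ} (p : Cone M δ × Cone M δ) (y : M) : ℝ :=
  Real.log (bump p.2 y / bump p.1 y ^ 2)

/-- `φ₂ = log ((1 + t̃₁² d(x₁, y)²) / (1 + t̃₂² d(x₂, y)²)²)`. -/
def φ₂ {δ : ℝ} (p : Cone M δ × Cone M δ) (y : M) : ℝ :=
  Real.log (bump p.1 y / bump p.2 y ^ 2)

end TestFunctions

end Toda

end

noncomputable section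

namespace Toda

/-! ### Charts and the metric in coordinates -/

section Charts

variable {M : Type*} [MetricSpace M] [ChartedSpace Plane M]

/-! Put ℓᵢ = log(1 + t̃ᵢ² d(xᵢ,·)²) and Tᵢ = log max(1, t̃ᵢ). Then φ₁ = ℓ₂ - 2ℓ₁ and φ₂ = ℓ₁ - 2ℓ₂,
and every term of J is estimated in T₁ and T₂ up to a uniformly bounded error.

Energy. The density is |∇ℓ₁|² + |∇ℓ₂|² - ∇ℓ₁·∇ℓ₂. Since |∇ℓᵢ| ≤ min(t̃ᵢ, 2/d(xᵢ,·)) and small balls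
have area at most κr², with κ as close to π as desired, the layer-cake formula gives ∫|∇ℓᵢ|² ≤ 8κTᵢ
+ O(1) (`integral_radialSlope_sq_le`). The cross term is O(1) because the bubbles do not collide:
some t̃ᵢ is bounded, or the points are a fixed distance apart (`separated`, `radialSlope_mul_le`).

Remaining terms. One has ∫ℓᵢ = 2Tᵢ + O(1) and -log ∫h₁exp(φ₁) ≤ 2T₁ - 2T₂ + O(1)
(`exists_neg_log_integral_le`), so ∫φ₁ - log ∫h₁exp(φ₁) ≤ -2T₁ + O(1), and symmetrically for φ₂.
Hence J ≤ (8κ - 2ρ₁)T₁ + (8κ - 2ρ₂)T₂ + O(1) (`exists_J_le`). Both coefficients are negative for κ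
close to π, since ρᵢ > 4π, and one of the Tᵢ is at least log(1/ν).

The constant π comes from comparing the metric in a chart with a constant one
(`exists_local_comparison`, `exists_ball_volume_le`). The distance is only Lipschitz, so gradients
rest on Rademacher's theorem: the pointwise gradient `ptGrad` is a weak gradient, is bounded by the
pointwise Lipschitz constant, and agrees almost everywhere with `grad` (`isWeakGradient_ptGrad`,
`norm_ptGrad_le`, `ae_grad_eq`). -/

/-- The differential of the inverse of a chart, as a linear map of the coordinate plane. -/
def coordMap (e : OpenPartialHomeomorph M Plane) (z : Plane) : Plane →L[ℝ] Plane :=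
  mfderiv 𝓘(ℝ, Plane) (𝓡 2) e.symm z

/-- The differential of a chart, as a linear map of the coordinate plane. -/
def chartMap (e : OpenPartialHomeomorph M Plane) (x : M) : Plane →L[ℝ] Plane :=
  mfderiv (𝓡 2) 𝓘(ℝ, Plane) e x

section Manifold

variable [IsManifold (𝓡 2) ∞ M] {e e' : OpenPartialHomeomorph M Plane}

theorem contMDiffOn_chart (he : e ∈ atlas Plane M) :
    ContMDiffOn (𝓡 2) (𝓡 2) ∞ e e.source :=
  contMDiffOn_of_mem_maximalAtlas (IsManifold.subset_maximalAtlas he)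

theorem contMDiffOn_chart_symm (he : e ∈ atlas Plane M) :
    ContMDiffOn (𝓡 2) (𝓡 2) ∞ e.symm e.target :=
  contMDiffOn_symm_of_mem_maximalAtlas (IsManifold.subset_maximalAtlas he)

theorem mdifferentiableAt_chart (he : e ∈ atlas Plane M) {x : M} (hx : x ∈ e.source) :
    MDifferentiableAt (𝓡 2) (𝓡 2) e x :=
  ((contMDiffOn_chart he).contMDiffAt (e.open_source.mem_nhds hx)).mdifferentiableAt (by simp)

theorem mdifferentiableAt_chart_symm (he : e ∈ atlas Plane M) {z : Plane} (hz : z ∈ e.target) :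
    MDifferentiableAt (𝓡 2) (𝓡 2) e.symm z :=
  ((contMDiffOn_chart_symm he).contMDiffAt (e.open_target.mem_nhds hz)).mdifferentiableAt (by simp)

theorem chartMap_coordMap (he : e ∈ atlas Plane M) {z : Plane} (hz : z ∈ e.target) (v : Plane) :
    chartMap e (e.symm z) (coordMap e z v) = v := by
  have h := (mdifferentiable_of_mem_atlas (I := 𝓡 2) he).comp_symm_deriv hz
  exact congrArg (fun f : Plane →L[ℝ] Plane ↦ f v) h

theorem coordMap_chartMap (he : e ∈ atlas Plane M) {x : M} (hx : x ∈ e.source) (v : Plane) :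
    coordMap e (e x) (chartMap e x v) = v := by
  have h := (mdifferentiable_of_mem_atlas (I := 𝓡 2) he).symm_comp_deriv hx
  exact congrArg (fun f : Plane →L[ℝ] Plane ↦ f v) h

theorem coordMap_bijective (he : e ∈ atlas Plane M) {z : Plane} (hz : z ∈ e.target) :
    Function.Bijective (coordMap e z) := by
  refine ⟨Function.LeftInverse.injective (g := chartMap e (e.symm z)) (chartMap_coordMap he hz),
    fun v ↦ ⟨chartMap e (e.symm z) v, ?_⟩⟩
  have := coordMap_chartMap he (e.map_target hz) v
  rwa [e.right_inv hz] at this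

/-- The transition map between two charts is differentiable. -/
theorem differentiableAt_transition (he : e ∈ atlas Plane M) (he' : e' ∈ atlas Plane M)
    {z : Plane} (hz : z ∈ e'.target) (hz' : e'.symm z ∈ e.source) :
    DifferentiableAt ℝ (e ∘ e'.symm) z :=
  ((mdifferentiableAt_chart he hz').comp z
    (mdifferentiableAt_chart_symm he' hz)).differentiableAt

theorem fderiv_transition (he : e ∈ atlas Plane M) (he' : e' ∈ atlas Plane M)
    {z : Plane} (hz : z ∈ e'.target) (hz' : e'.symm z ∈ e.source) (v : Plane) :
    fderiv ℝ (e ∘ e'.symm) z v = chartMap e (e'.symm z) (coordMap e' z v) := by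
  have h := mfderiv_comp z (mdifferentiableAt_chart he hz') (mdifferentiableAt_chart_symm he' hz)
  rw [mfderiv_eq_fderiv] at h
  exact congrArg (fun f : Plane →L[ℝ] Plane ↦ f v) h

/-- The chain rule for the change of charts. -/
theorem coordMap_transition (he : e ∈ atlas Plane M) (he' : e' ∈ atlas Plane M)
    {z : Plane} (hz : z ∈ e'.target) (hz' : e'.symm z ∈ e.source) (v : Plane) :
    coordMap e (e (e'.symm z)) (fderiv ℝ (e ∘ e'.symm) z v) = coordMap e' z v := by
  rw [fderiv_transition he he' hz hz', coordMap_chartMap he hz']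

end Manifold

theorem coordVec_add (e : OpenPartialHomeomorph M Plane) (z v w : Plane) :
    coordVec e z (v + w) = coordVec e z v + coordVec e z w :=
  map_add (mfderiv 𝓘(ℝ, Plane) (𝓡 2) e.symm z) v w

theorem coordVec_smul (e : OpenPartialHomeomorph M Plane) (z : Plane) (c : ℝ) (v : Plane) :
    coordVec e z (c • v) = c • coordVec e z v :=
  map_smul (mfderiv 𝓘(ℝ, Plane) (𝓡 2) e.symm z) c v

theorem plane_eq (v : Plane) :
    v = v 0 • EuclideanSpace.single 0 1 + v 1 • EuclideanSpace.single 1 1 := by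
  ext i
  fin_cases i <;> simp

theorem det_plane (D : Plane →L[ℝ] Plane) :
    D.det = D (EuclideanSpace.single 0 1) 0 * D (EuclideanSpace.single 1 1) 1 -
      D (EuclideanSpace.single 1 1) 0 * D (EuclideanSpace.single 0 1) 1 := by
  have : D.det = LinearMap.det (D : Plane →ₗ[ℝ] Plane) := rfl
  rw [this, ← LinearMap.det_toMatrix (EuclideanSpace.basisFun (Fin 2) ℝ).toBasis,
    Matrix.det_fin_two]
  simp [LinearMap.toMatrix_apply]

variable [RiemannianBundle (fun x : M ↦ TangentSpace (𝓡 2) x)]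

/-- The metric at `x`, as a function on the model of the tangent space. -/
def metricAt (x : M) (v w : Plane) : ℝ :=
  inner ℝ (show TangentSpace (𝓡 2) x from v) (show TangentSpace (𝓡 2) x from w)

/-- The metric in the coordinates of a chart. -/
def chartMetric (e : OpenPartialHomeomorph M Plane) (z v w : Plane) : ℝ :=
  metricAt (e.symm z) (coordMap e z v) (coordMap e z w)

/-- The norm of coordinate vectors. -/
def chartNorm (e : OpenPartialHomeomorph M Plane) (z v : Plane) : ℝ := ‖coordVec e z v‖

theorem inner_coordVec (e : OpenPartialHomeomorph M Plane) (z v w : Plane) :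
    inner ℝ (coordVec e z v) (coordVec e z w) = chartMetric e z v w := rfl

theorem chartNorm_nonneg (e : OpenPartialHomeomorph M Plane) (z v : Plane) :
    0 ≤ chartNorm e z v := norm_nonneg _

theorem chartNorm_sq (e : OpenPartialHomeomorph M Plane) (z v : Plane) :
    chartNorm e z v ^ 2 = chartMetric e z v v :=
  (real_inner_self_eq_norm_sq (coordVec e z v)).symm

theorem gram_apply (e : OpenPartialHomeomorph M Plane) (z : Plane) (i j : Fin 2) :
    gram e z i j =
      chartMetric e z (EuclideanSpace.single i 1) (EuclideanSpace.single j 1) := rfl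

theorem chartMetric_comm (e : OpenPartialHomeomorph M Plane) (z v w : Plane) :
    chartMetric e z v w = chartMetric e z w v := by
  rw [← inner_coordVec, ← inner_coordVec, real_inner_comm]

theorem chartMetric_eq_gram (e : OpenPartialHomeomorph M Plane) (z v w : Plane) :
    chartMetric e z v w = v 0 * w 0 * gram e z 0 0 + (v 0 * w 1 + v 1 * w 0) * gram e z 0 1 +
      v 1 * w 1 * gram e z 1 1 := by
  have h10 : gram e z 1 0 = gram e z 0 1 := chartMetric_comm _ _ _ _
  rw [← inner_coordVec]
  conv_lhs => rw [plane_eq v, plane_eq w]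
  simp only [coordVec_add, coordVec_smul, inner_add_left, inner_add_right, real_inner_smul_left,
    real_inner_smul_right, inner_coordVec, ← gram_apply, h10]
  ring

section Manifold

variable [IsManifold (𝓡 2) ∞ M] {e e' : OpenPartialHomeomorph M Plane}

theorem chartNorm_pos (he : e ∈ atlas Plane M) {z : Plane} (hz : z ∈ e.target) {v : Plane}
    (hv : v ≠ 0) : 0 < chartNorm e z v := by
  refine norm_pos_iff.2 fun h ↦ hv ((coordMap_bijective he hz).1 ?_)
  rw [map_zero]
  exact h

/-- The metric in two charts. -/
theorem chartMetric_transition (he : e ∈ atlas Plane M) (he' : e' ∈ atlas Plane M)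
    {z : Plane} (hz : z ∈ e'.target) (hz' : e'.symm z ∈ e.source) (v w : Plane) :
    chartMetric e' z v w = chartMetric e (e (e'.symm z)) (fderiv ℝ (e ∘ e'.symm) z v)
      (fderiv ℝ (e ∘ e'.symm) z w) := by
  unfold chartMetric
  rw [coordMap_transition he he' hz hz', coordMap_transition he he' hz hz', e.left_inv hz']

/-- There are linear coordinates in which the metric at a given point is the Euclidean one. -/
theorem exists_linear_isometry (he : e ∈ atlas Plane M) {z : Plane} (hz : z ∈ e.target) :
    ∃ A : Plane →L[ℝ] Plane, (∀ v, chartNorm e z v = ‖A v‖) ∧ A.det ≠ 0 ∧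
      (gram e z).det = A.det ^ 2 := by
  have hfin : FiniteDimensional ℝ (TangentSpace (𝓡 2) (e.symm z)) :=
    inferInstanceAs (FiniteDimensional ℝ Plane)
  have hrank : Module.finrank ℝ (TangentSpace (𝓡 2) (e.symm z)) = 2 :=
    (finrank_euclideanSpace_fin (𝕜 := ℝ) (n := 2))
  -- `A` expresses coordinate vectors in an orthonormal basis of the tangent space, so the Gram
  -- matrix is AᵀA.
  let ψ := ((stdOrthonormalBasis ℝ (TangentSpace (𝓡 2) (e.symm z))).reindex
    (finCongr hrank)).repr
  let A₀ : Plane →ₗ[ℝ] Plane :=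
    { toFun := fun v ↦ ψ (coordVec e z v)
      map_add' := fun v w ↦ by rw [coordVec_add, map_add]
      map_smul' := fun c v ↦ by rw [coordVec_smul, map_smul]; rfl }
  let A : Plane →L[ℝ] Plane := LinearMap.toContinuousLinearMap A₀
  have hA : ∀ v w, inner ℝ (A v) (A w) = chartMetric e z v w := fun v w ↦
    ψ.inner_map_map (coordVec e z v) (coordVec e z w)
  have hn : ∀ v, chartNorm e z v = ‖A v‖ := fun v ↦ (ψ.norm_map (coordVec e z v)).symm
  refine ⟨A, hn, ?_, ?_⟩
  · have hinj : Function.Injective A₀ := by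
      refine (injective_iff_map_eq_zero A₀).2 fun v hv ↦ ?_
      by_contra h
      have := chartNorm_pos he hz h
      rw [hn v] at this
      exact this.ne' (by rw [show A v = 0 from hv, norm_zero])
    exact (LinearEquiv.ofInjectiveEndo A₀ hinj).isUnit_det'.ne_zero
  · have hg : ∀ i j, gram e z i j =
        A (EuclideanSpace.single i 1) 0 * A (EuclideanSpace.single j 1) 0 +
        A (EuclideanSpace.single i 1) 1 * A (EuclideanSpace.single j 1) 1 := by
      intro i j
      rw [gram_apply, ← hA, PiLp.inner_apply, Fin.sum_univ_two]
      simp [mul_comm]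
    rw [Matrix.det_fin_two, det_plane, hg, hg, hg, hg]
    ring

theorem gram_det_pos (he : e ∈ atlas Plane M) {z : Plane} (hz : z ∈ e.target) :
    0 < (gram e z).det := by
  obtain ⟨A, -, hA, h⟩ := exists_linear_isometry he hz
  rw [h]
  positivity

/-- The Gram matrix transforms as DᵀGD. The squared Jacobian is what makes √det G a density
independent of the chart. -/
theorem gram_det_transition (he : e ∈ atlas Plane M) (he' : e' ∈ atlas Plane M)
    {z : Plane} (hz : z ∈ e'.target) (hz' : e'.symm z ∈ e.source) :
    (gram e' z).det = (fderiv ℝ (e ∘ e'.symm) z).det ^ 2 * (gram e (e (e'.symm z))).det := by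
  set D := fderiv ℝ (e ∘ e'.symm) z
  have h10 : gram e (e (e'.symm z)) 1 0 = gram e (e (e'.symm z)) 0 1 := chartMetric_comm _ _ _ _
  rw [Matrix.det_fin_two, Matrix.det_fin_two, det_plane, h10]
  simp only [gram_apply e', chartMetric_transition he he' hz hz', chartMetric_eq_gram e]
  ring

end Manifold

end Charts

/-- Converts coefficientwise errors of the Gram matrix, measured by ‖v‖², into errors relative to ‖A
v‖². -/
theorem exists_mul_norm_sq_le {A : Plane →L[ℝ] Plane} (hdet : A.det ≠ 0) :
    ∃ c > 0, ∀ v, c * ‖v‖ ^ 2 ≤ ‖A v‖ ^ 2 := by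
  let B := LinearEquiv.ofIsUnitDet (f := (A : Plane →ₗ[ℝ] Plane))
    (v := (EuclideanSpace.basisFun (Fin 2) ℝ).toBasis)
    (v' := (EuclideanSpace.basisFun (Fin 2) ℝ).toBasis)
    (by rw [LinearMap.det_toMatrix]; exact isUnit_iff_ne_zero.2 hdet)
  let B' := B.toContinuousLinearEquiv
  obtain ⟨K, hK, hK'⟩ := (B'.symm : Plane →L[ℝ] Plane).bound
  refine ⟨(K ^ 2)⁻¹, by positivity, fun v ↦ ?_⟩
  have h := hK' (B' v)
  have h1 : (B'.symm : Plane →L[ℝ] Plane) (B' v) = v := B'.symm_apply_apply v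
  have h2 : B' v = A v := rfl
  rw [h1, h2] at h
  rw [inv_mul_le_iff₀ (by positivity), ← mul_pow]
  gcongr

/-! ### Continuity of the metric and comparison with a constant metric. -/

section Local

variable {M : Type*} [MetricSpace M] [ChartedSpace Plane M]
  [RiemannianBundle (fun x : M ↦ TangentSpace (𝓡 2) x)]
  [IsManifold (𝓡 2) ∞ M]
  [IsContMDiffRiemannianBundle (𝓡 2) ∞ Plane (fun x : M ↦ TangentSpace (𝓡 2) x)]
  {e e' : OpenPartialHomeomorph M Plane}

/-- Coordinate fields are the tangent map of `e.symm` applied to constant fields, hence continuous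
sections, and the bundle metric is continuous. -/
theorem continuousOn_chartMetric (he : e ∈ atlas Plane M) (v w : Plane) :
    ContinuousOn (fun z ↦ chartMetric e z v w) e.target := by
  have hc : IsContinuousRiemannianBundle Plane (fun x : M ↦ TangentSpace (𝓡 2) x) := by
    obtain ⟨g, hg, h⟩ := IsContMDiffRiemannianBundle.exists_contMDiff (IB := 𝓡 2) (n := ∞)
      (F := Plane) (E := fun x : M ↦ TangentSpace (𝓡 2) x)
    exact ⟨g, hg.continuous, h⟩
  have hs : ∀ v : Plane, ContinuousOn
      (fun z ↦ (⟨e.symm z, coordVec e z v⟩ : TangentBundle (𝓡 2) M)) e.target := by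
    intro v
    have h1 := (contMDiffOn_chart_symm he).continuousOn_tangentMapWithin (by simp)
      e.open_target.uniqueMDiffOn
    have h2 : Continuous fun z : Plane ↦ (⟨z, v⟩ : TangentBundle (𝓡 2) Plane) := by
      have := (tangentBundleModelSpaceHomeomorph (𝓡 2) (H := Plane)).symm.continuous.comp
        (Continuous.prodMk_left v)
      exact this
    refine (h1.comp h2.continuousOn fun z hz ↦ hz).congr fun z hz ↦ ?_
    simp only [Function.comp_apply, tangentMapWithin]
    rw [mfderivWithin_of_isOpen e.open_target hz]
    rfl
  exact (hs v).inner_bundle (hs w)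

theorem continuousOn_gram (he : e ∈ atlas Plane M) (i j : Fin 2) :
    ContinuousOn (fun z ↦ gram e z i j) e.target :=
  continuousOn_chartMetric he _ _

theorem continuousOn_gram_det (he : e ∈ atlas Plane M) :
    ContinuousOn (fun z ↦ (gram e z).det) e.target := by
  simp only [Matrix.det_fin_two]
  exact ((continuousOn_gram he 0 0).mul (continuousOn_gram he 1 1)).sub
    ((continuousOn_gram he 0 1).mul (continuousOn_gram he 1 0))

theorem continuousOn_chartNorm (he : e ∈ atlas Plane M) (v : Plane) :
    ContinuousOn (fun z ↦ chartNorm e z v) e.target := by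
  refine (continuousOn_chartMetric he v v).sqrt.congr fun z _ ↦ ?_
  simp only [← chartNorm_sq, Real.sqrt_sq (chartNorm_nonneg e z v)]

/-- The norms of coordinate vectors at nearby points are comparable, with constants close to
one. -/
theorem eventually_chartNorm_sq (he : e ∈ atlas Plane M) {z₀ : Plane} (hz₀ : z₀ ∈ e.target)
    {ε : ℝ} (hε : 0 < ε) :
    ∀ᶠ z in 𝓝 z₀, ∀ v, |chartNorm e z v ^ 2 - chartNorm e z₀ v ^ 2| ≤
      ε * chartNorm e z₀ v ^ 2 := by
  obtain ⟨A, hA, hdet, -⟩ := exists_linear_isometry he hz₀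
  obtain ⟨c, hc, hcA⟩ := exists_mul_norm_sq_le hdet
  -- The quadratic form has four terms, the off-diagonal one counting twice, each with |vᵢvⱼ| ≤
  -- ‖v‖². The total error is at most εc‖v‖² ≤ ε‖A v‖².
  have hg : ∀ i j, ∀ᶠ z in 𝓝 z₀, |gram e z i j - gram e z₀ i j| < ε * c / 4 := fun i j ↦ by
    have h := (continuousOn_gram he i j).continuousAt (e.open_target.mem_nhds hz₀)
    exact Metric.tendsto_nhds.1 h (ε * c / 4) (by positivity)
  filter_upwards [hg 0 0, hg 0 1, hg 1 1] with z h1 h2 h3 v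
  rw [chartNorm_sq, chartNorm_sq, chartMetric_eq_gram, chartMetric_eq_gram]
  have h4 := hcA v
  rw [← hA, chartNorm_sq, chartMetric_eq_gram] at h4
  have h5 : ‖v‖ ^ 2 = v 0 ^ 2 + v 1 ^ 2 := by
    rw [EuclideanSpace.norm_sq_eq, Fin.sum_univ_two]; simp
  have h6 : ∀ a b k : ℝ, |a - b| < ε * c / 4 → |k| ≤ ‖v‖ ^ 2 →
      |k * (a - b)| ≤ ‖v‖ ^ 2 * (ε * c / 4) := fun a b k h h' ↦ by
    rw [abs_mul]
    gcongr
  have k1 := h6 _ _ (v 0 * v 0) h1 (by rw [abs_le]; constructor <;> nlinarith)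
  have k2 := h6 _ _ (v 0 * v 1) h2 (by
    rw [abs_le]; constructor <;> nlinarith [sq_nonneg (v 0 + v 1), sq_nonneg (v 0 - v 1)])
  have k3 := h6 _ _ (v 1 * v 1) h3 (by rw [abs_le]; constructor <;> nlinarith)
  rw [abs_le] at k1 k2 k3 ⊢
  have h7 := mul_le_mul_of_nonneg_left h4 hε.le
  constructor <;> nlinarith

/-- Near a given point, the metric is comparable with a constant one, with constants close to
one. -/
theorem exists_local_comparison (he : e ∈ atlas Plane M) {z₀ : Plane} (hz₀ : z₀ ∈ e.target)
    {ε : ℝ} (hε : 0 < ε) (hε1 : ε < 1) :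
    ∃ A : Plane →L[ℝ] Plane, A.det ≠ 0 ∧ (∀ v, chartNorm e z₀ v = ‖A v‖) ∧
      ∃ s > 0, Metric.ball z₀ s ⊆ e.target ∧ ∀ z ∈ Metric.ball z₀ s,
        (∀ v, (1 - ε) * ‖A v‖ ≤ chartNorm e z v ∧ chartNorm e z v ≤ (1 + ε) * ‖A v‖) ∧
        (1 - ε) * |A.det| ≤ √(gram e z).det ∧ √(gram e z).det ≤ (1 + ε) * |A.det| := by
  obtain ⟨A, hA, hdet, hgram⟩ := exists_linear_isometry he hz₀
  refine ⟨A, hdet, hA, ?_⟩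
  have h1 : ∀ᶠ z in 𝓝 z₀, z ∈ e.target := e.open_target.mem_nhds hz₀
  have h2 := eventually_chartNorm_sq he hz₀ hε
  have h3 : ∀ᶠ z in 𝓝 z₀, |√(gram e z).det - abs A.det| < ε * |A.det| := by
    have h := (continuousOn_gram_det he).sqrt.continuousAt (e.open_target.mem_nhds hz₀)
    have h' := Metric.tendsto_nhds.1 h (ε * |A.det|) (by positivity)
    simp only [hgram, Real.sqrt_sq_eq_abs] at h'
    exact h'
  obtain ⟨s, hs, hsub⟩ := Metric.eventually_nhds_iff_ball.1 (h1.and (h2.and h3))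
  refine ⟨s, hs, fun z hz ↦ (hsub z hz).1, fun z hz ↦ ⟨fun v ↦ ?_, ?_, ?_⟩⟩
  · have h := (hsub z hz).2.1 v
    rw [hA, abs_le] at h
    have hn := chartNorm_nonneg e z v
    -- Square roots are taken using (1 - ε)² ≤ 1 - ε and 1 + ε ≤ (1 + ε)².
    constructor
    · refine le_of_sq_le_sq ?_ hn
      nlinarith [sq_nonneg ‖A v‖]
    · refine le_of_sq_le_sq ?_ (by positivity)
      nlinarith [sq_nonneg ‖A v‖]
  · have h := (abs_lt.1 (hsub z hz).2.2).1
    linarith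
  · have h := (abs_lt.1 (hsub z hz).2.2).2
    linarith

end Local

/-! ### Riemannian distance against distance in a chart. -/

section Distance

variable {M : Type*} [MetricSpace M] [ChartedSpace Plane M]
  [RiemannianBundle (fun x : M ↦ TangentSpace (𝓡 2) x)]
  [IsManifold (𝓡 2) ∞ M]
  {e : OpenPartialHomeomorph M Plane}

/-- A lower bound for the length of a path in the domain of a chart. -/
theorem le_pathELength (he : e ∈ atlas Plane M) (A : Plane →L[ℝ] Plane) {c : ℝ} (hc : 0 ≤ c)
    {γ : ℝ → M} (hγ : ContMDiff 𝓘(ℝ, ℝ) (𝓡 2) 1 γ)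
    (hmem : ∀ t ∈ Icc (0 : ℝ) 1, γ t ∈ e.source)
    (hA : ∀ t ∈ Icc (0 : ℝ) 1, ∀ v, c * ‖A v‖ ≤ chartNorm e (e (γ t)) v) :
    ENNReal.ofReal (c * ‖A (e (γ 1) - e (γ 0))‖) ≤ pathELength (𝓡 2) γ 0 1 := by
  have hsm : ContMDiffOn 𝓘(ℝ, ℝ) (𝓡 2) 1 (e ∘ γ) (Icc 0 1) :=
    ((contMDiffOn_chart he).of_le (by simp)).comp hγ.contMDiffOn hmem
  have hsm' : ContDiffOn ℝ 1 (e ∘ γ) (Icc 0 1) := contMDiffOn_iff_contDiffOn.1 hsm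
  have hf : ContDiffOn ℝ 1 (fun t ↦ (c • A) ((e ∘ γ) t)) (Icc 0 1) :=
    (c • A).contDiff.comp_contDiffOn hsm'
  have h1 := enorm_sub_le_lintegral_derivWithin_Icc_of_contDiffOn_Icc hf zero_le_one
  have h2 : ENNReal.ofReal (c * ‖A (e (γ 1) - e (γ 0))‖) =
      ‖(c • A) ((e ∘ γ) 1) - (c • A) ((e ∘ γ) 0)‖ₑ := by
    rw [← map_sub, ← ofReal_norm]
    simp [norm_smul, abs_of_nonneg hc]
  rw [h2, pathELength_eq_lintegral_mfderivWithin_Icc]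
  refine h1.trans (setLIntegral_mono' measurableSet_Icc fun t ht ↦ ?_)
  have hu := uniqueDiffOn_Icc (zero_lt_one (α := ℝ)) t ht
  have hd : derivWithin (fun t ↦ (c • A) ((e ∘ γ) t)) (Icc 0 1) t =
      (c • A) (derivWithin (e ∘ γ) (Icc 0 1) t) := by
    have := ((hsm'.differentiableOn one_ne_zero) t ht).hasDerivWithinAt
    exact ((c • A).hasFDerivAt.comp_hasDerivWithinAt t this).derivWithin hu
  set w : Plane := mfderivWithin 𝓘(ℝ, ℝ) (𝓡 2) γ (Icc 0 1) t (1 : ℝ) with hw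
  have h3 : mfderivWithin 𝓘(ℝ, ℝ) (𝓡 2) (e ∘ γ) (Icc 0 1) t =
      (mfderiv (𝓡 2) (𝓡 2) e (γ t)).comp (mfderivWithin 𝓘(ℝ, ℝ) (𝓡 2) γ (Icc 0 1) t) :=
    mfderiv_comp_mfderivWithin t (mdifferentiableAt_chart he (hmem t ht))
      ((hγ.mdifferentiable one_ne_zero).mdifferentiableOn t (mem_univ t) |>.mono (subset_univ _))
      ((uniqueDiffOn_Icc zero_lt_one).uniqueMDiffOn t ht)
  have h4 : derivWithin (e ∘ γ) (Icc 0 1) t = chartMap e (γ t) w := by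
    rw [← fderivWithin_derivWithin, ← mfderivWithin_eq_fderivWithin, h3]
    rfl
  have h5 := hA t ht (chartMap e (γ t) w)
  have h6 : chartNorm e (e (γ t)) (chartMap e (γ t) w) =
      ‖mfderivWithin 𝓘(ℝ, ℝ) (𝓡 2) γ (Icc 0 1) t (1 : ℝ)‖ := by
    -- The points `e.symm (e (γ t))` and `γ t` are equal but index different tangent spaces; the
    -- norm is transported along this equality.
    have k : ∀ (x y : M) (_ : x = y) (v : Plane), ‖(show TangentSpace (𝓡 2) x from v)‖ =
        ‖(show TangentSpace (𝓡 2) y from v)‖ := by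
      rintro x _ rfl v
      rfl
    have k1 := k _ _ (e.left_inv (hmem t ht)) (coordMap e (e (γ t)) (chartMap e (γ t) w))
    rw [coordMap_chartMap he (hmem t ht)] at k1
    rw [← k1]
    conv_rhs => rw [← coordMap_chartMap he (hmem t ht) w]
    rfl
  rw [h6] at h5
  rw [hd, h4, ← ofReal_norm, ← ofReal_norm]
  refine ENNReal.ofReal_le_ofReal (le_trans (le_of_eq ?_) h5)
  simp [norm_smul, abs_of_nonneg hc]

variable [IsRiemannianManifold (𝓡 2) M]

/-- The distance of two points of a chart is at most the length of the coordinate segment. -/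
theorem dist_symm_le (he : e ∈ atlas Plane M) {z z' : Plane} {C : ℝ} (hC : 0 ≤ C)
    (hs : segment ℝ z z' ⊆ e.target)
    (h : ∀ w ∈ segment ℝ z z', chartNorm e w (z' - z) ≤ C) :
    dist (e.symm z) (e.symm z') ≤ C := by
  let η := ContinuousAffineMap.lineMap (R := ℝ) z z'
  have hη : ∀ t ∈ Icc (0 : ℝ) 1, η t ∈ segment ℝ z z' := fun t ht ↦ by
    rw [segment_eq_image_lineMap]
    exact ⟨t, ht, rfl⟩
  have hsm : ContMDiffOn 𝓘(ℝ, ℝ) (𝓡 2) 1 η (Icc 0 1) := by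
    apply ContMDiff.contMDiffOn
    rw [contMDiff_iff_contDiff]
    exact ContinuousAffineMap.contDiff _
  have hlen : edist (e.symm z) (e.symm z') ≤ pathELength (𝓡 2) (e.symm ∘ η) 0 1 := by
    rw [IsRiemannianManifold.out (I := 𝓡 2) (e.symm z) (e.symm z')]
    refine riemannianEDist_le_pathELength ?_ ?_ ?_ zero_le_one
    · exact ((contMDiffOn_chart_symm he).of_le (by simp)).comp hsm fun t ht ↦ hs (hη t ht)
    · simp [η, ContinuousAffineMap.coe_lineMap_eq]
    · simp [η, ContinuousAffineMap.coe_lineMap_eq]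
  have hle : pathELength (𝓡 2) (e.symm ∘ η) 0 1 ≤ ENNReal.ofReal C := by
    rw [pathELength_eq_lintegral_mfderivWithin_Icc]
    calc _ ≤ ∫⁻ t in Icc (0 : ℝ) 1, ENNReal.ofReal C := by
          refine setLIntegral_mono' measurableSet_Icc fun t ht ↦ ?_
          have hd : HasDerivWithinAt η (z' - z) (Icc 0 1) t := by
            have := (AffineMap.hasDerivAt_lineMap (a := z) (b := z') (x := t)).hasDerivWithinAt
              (s := Icc (0 : ℝ) 1)
            exact this
          have h1 : mfderivWithin 𝓘(ℝ, ℝ) (𝓡 2) (e.symm ∘ η) (Icc 0 1) t =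
              (mfderiv (𝓡 2) (𝓡 2) e.symm (η t)).comp
                (mfderivWithin 𝓘(ℝ, ℝ) (𝓡 2) η (Icc 0 1) t) :=
            mfderiv_comp_mfderivWithin t (mdifferentiableAt_chart_symm he (hs (hη t ht)))
              (hsm.mdifferentiableOn one_ne_zero t ht)
              ((uniqueDiffOn_Icc zero_lt_one).uniqueMDiffOn t ht)
          have h2 : mfderivWithin 𝓘(ℝ, ℝ) (𝓡 2) η (Icc 0 1) t (1 : ℝ) = z' - z := by
            rw [mfderivWithin_eq_fderivWithin]
            rw [hd.hasFDerivWithinAt.fderivWithin (uniqueDiffOn_Icc zero_lt_one t ht)]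
            exact one_smul ℝ (z' - z)
          have h3 : mfderivWithin 𝓘(ℝ, ℝ) (𝓡 2) (e.symm ∘ η) (Icc 0 1) t (1 : ℝ) =
              coordVec e (η t) (z' - z) := by
            rw [h1]
            exact congrArg (mfderiv (𝓡 2) (𝓡 2) e.symm (η t)) h2
          have h4 := h (η t) (hη t ht)
          calc ‖mfderivWithin 𝓘(ℝ, ℝ) (𝓡 2) (e.symm ∘ η) (Icc 0 1) t (1 : ℝ)‖ₑ
              = ‖coordVec e (η t) (z' - z)‖ₑ := by rw [h3]
            _ ≤ ENNReal.ofReal C := by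
              rw [← ofReal_norm]
              exact ENNReal.ofReal_le_ofReal h4
      _ = ENNReal.ofReal C := by simp
  have := hlen.trans hle
  rwa [edist_dist, ENNReal.ofReal_le_ofReal_iff hC] at this

/-- An almost minimal path between two points of the ball of radius R is shorter than 2R. It
therefore stays in the ball of radius 3R, inside the chart, where `le_pathELength` bounds its length
from below. -/
theorem le_dist_of_ball_subset (he : e ∈ atlas Plane M) (A : Plane →L[ℝ] Plane) {c : ℝ}
    (hc : 0 ≤ c) {p : M} {R : ℝ} (hsub : Metric.ball p (3 * R) ⊆ e.source)
    (hA : ∀ x ∈ Metric.ball p (3 * R), ∀ v, c * ‖A v‖ ≤ chartNorm e (e x) v) {x y : M}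
    (hx : x ∈ Metric.ball p R) (hy : y ∈ Metric.ball p R) :
    c * ‖A (e x - e y)‖ ≤ dist x y := by
  have hxy : dist x y < 2 * R := by
    have := dist_triangle_right x y p
    rw [Metric.mem_ball] at hx hy
    linarith
  refine le_of_forall_gt_imp_ge_of_dense fun r hr ↦ ?_
  set r' := min r (2 * R)
  have hr' : dist x y < r' := lt_min hr hxy
  have hr0 : 0 ≤ r' := dist_nonneg.trans hr'.le
  have h1 : riemannianEDist (𝓡 2) y x < ENNReal.ofReal r' := by
    rw [← IsRiemannianManifold.out (I := 𝓡 2) y x, edist_dist, dist_comm]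
    exact (ENNReal.ofReal_lt_ofReal_iff (dist_nonneg.trans_lt hr')).2 hr'
  obtain ⟨γ, hγ0, hγ1, hγ, hlen, -⟩ := exists_lt_locally_constant_of_riemannianEDist_lt h1
    (zero_lt_one (α := ℝ))
  have hball : ∀ t ∈ Icc (0 : ℝ) 1, γ t ∈ Metric.ball p (3 * R) := fun t ht ↦ by
    have h2 : edist y (γ t) < ENNReal.ofReal r' := by
      rw [IsRiemannianManifold.out (I := 𝓡 2) y (γ t)]
      exact ((riemannianEDist_le_pathELength hγ.contMDiffOn hγ0 rfl ht.1).trans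
        (pathELength_mono le_rfl ht.2)).trans_lt hlen
    rw [edist_dist, ENNReal.ofReal_lt_ofReal_iff (dist_nonneg.trans_lt hr')] at h2
    rw [Metric.mem_ball] at hy ⊢
    have := dist_triangle_left (γ t) p y
    have := min_le_right r (2 * R)
    linarith
  have h3 := (le_pathELength he A hc hγ (fun t ht ↦ hsub (hball t ht))
    fun t ht ↦ hA _ (hball t ht)).trans hlen.le
  rw [hγ0, hγ1, ENNReal.ofReal_le_ofReal_iff hr0] at h3
  exact h3.trans (min_le_left _ _)

end Distance

/-! ### The Riemannian volume -/

theorem measurableSet_inter_preimage {α β : Type*} [TopologicalSpace α] [MeasurableSpace α]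
    [OpensMeasurableSpace α] [TopologicalSpace β] [MeasurableSpace β] [BorelSpace β]
    {f : α → β} {t : Set α} {s : Set β} (hf : ContinuousOn f t) (ht : MeasurableSet t)
    (hs : MeasurableSet s) : MeasurableSet (t ∩ f ⁻¹' s) := by
  have h := ht.subtype_image (hf.domRestrict.measurable hs)
  rwa [domRestrict_eq, preimage_comp, Subtype.image_preimage_coe] at h

theorem volume_linear_preimage {A : Plane →L[ℝ] Plane} (hdet : A.det ≠ 0) (w : Plane) {r : ℝ}
    (hr : 0 ≤ r) :
    volume {z | ‖A (z - w)‖ < r} = ENNReal.ofReal (|A.det|⁻¹ * (Real.pi * r ^ 2)) := by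
  have h := Measure.addHaar_preimage_linearMap volume (f := (A : Plane →ₗ[ℝ] Plane)) hdet
    (Metric.ball (A w) r)
  have h1 : ⇑(A : Plane →ₗ[ℝ] Plane) ⁻¹' Metric.ball (A w) r = {z | ‖A (z - w)‖ < r} := by
    ext z
    simp [dist_eq_norm]
  rw [← h1, h, EuclideanSpace.volume_ball_fin_two, ← ENNReal.ofReal_pow hr,
    ← ENNReal.ofReal_mul (by positivity), ← ENNReal.ofReal_mul (by positivity), abs_inv,
    mul_comm Real.pi]

section Volume

variable {M : Type*} [MetricSpace M] [ChartedSpace Plane M]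
  [RiemannianBundle (fun x : M ↦ TangentSpace (𝓡 2) x)]
  [MeasurableSpace M] [BorelSpace M] {e e' : OpenPartialHomeomorph M Plane}

theorem aemeasurable_chart_symm (e : OpenPartialHomeomorph M Plane) :
    AEMeasurable e.symm ((volume.restrict e.target).withDensity
      fun z ↦ ENNReal.ofReal (Real.sqrt (gram e z).det)) :=
  (e.continuousOn_symm.aemeasurable e.open_target.measurableSet).mono_ac
    (withDensity_absolutelyContinuous _ _)

theorem chartVolume_apply (e : OpenPartialHomeomorph M Plane) {S : Set M} (hS : MeasurableSet S) :
    chartVolume e S =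
      ∫⁻ z in e.target ∩ e.symm ⁻¹' S, ENNReal.ofReal (Real.sqrt (gram e z).det) := by
  rw [chartVolume, Measure.map_apply_of_aemeasurable (aemeasurable_chart_symm e) hS,
    withDensity_apply', Measure.restrict_restrict' e.open_target.measurableSet, inter_comm]

theorem chartVolume_compl_source (e : OpenPartialHomeomorph M Plane) :
    chartVolume e e.sourceᶜ = 0 := by
  rw [chartVolume_apply e e.open_source.measurableSet.compl]
  have : e.target ∩ e.symm ⁻¹' e.sourceᶜ = ∅ := by
    ext z
    simp only [mem_inter_iff, mem_preimage, mem_compl_iff, mem_empty_iff_false, iff_false,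
      not_and, not_not]
    exact fun hz ↦ e.map_target hz
  rw [this, Measure.restrict_empty, lintegral_zero_measure]

theorem chartVolume_restrict_source (e : OpenPartialHomeomorph M Plane) :
    (chartVolume e).restrict e.source = chartVolume e :=
  Measure.restrict_eq_self_of_ae_mem (by
    rw [ae_iff]
    exact chartVolume_compl_source e)

variable [IsManifold (𝓡 2) ∞ M]

/-- Change of variables along `e ∘ e'.symm`, with the Jacobian from `gram_det_transition`. Part of
`S` may lie outside the domain of `e'`, whence only an inequality; it suffices for a supremum. -/
theorem chartVolume_le_of_subset (he : e ∈ atlas Plane M) (he' : e' ∈ atlas Plane M) {S : Set M}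
    (hS : MeasurableSet S) (hsub : S ⊆ e.source) : chartVolume e' S ≤ chartVolume e S := by
  rw [chartVolume_apply e hS, chartVolume_apply e' hS]
  set s := e'.target ∩ e'.symm ⁻¹' S with hs
  have hsm : MeasurableSet s :=
    measurableSet_inter_preimage e'.continuousOn_symm e'.open_target.measurableSet hS
  have hinj : InjOn (e ∘ e'.symm) s := fun z hz w hw h ↦
    e'.symm.injOn hz.1 hw.1 (e.injOn (hsub hz.2) (hsub hw.2) h)
  have himg : (e ∘ e'.symm) '' s ⊆ e.target ∩ e.symm ⁻¹' S := by
    rintro _ ⟨z, hz, rfl⟩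
    refine ⟨e.map_source (hsub hz.2), ?_⟩
    simp only [Function.comp_apply, mem_preimage, e.left_inv (hsub hz.2)]
    exact hz.2
  refine le_trans (le_of_eq ?_) (lintegral_mono_set himg)
  rw [lintegral_image_eq_lintegral_abs_det_fderiv_mul volume hsm
    (fun z hz ↦ (differentiableAt_transition he he' hz.1
      (hsub hz.2)).hasFDerivAt.hasFDerivWithinAt) hinj]
  refine setLIntegral_congr_fun hsm fun z hz ↦ ?_
  simp only [Function.comp_apply]
  rw [gram_det_transition he he' hz.1 (hsub hz.2), Real.sqrt_mul (sq_nonneg _),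
    Real.sqrt_sq_eq_abs, ENNReal.ofReal_mul (abs_nonneg _)]

/-- In the domain of a chart, the Riemannian volume is given by the chart. -/
theorem riemVolume_restrict_source (he : e ∈ atlas Plane M) :
    (riemVolume M).restrict e.source = chartVolume e := by
  have hms := e.open_source.measurableSet
  have hle : ∀ e' ∈ atlas Plane M, chartVolume e' ≤ riemVolume M := fun e' he' ↦
    le_iSup₂ (f := fun e (_ : e ∈ atlas Plane M) ↦ chartVolume e) e' he'
  refine le_antisymm ?_ ?_
  -- The right-hand side bounds the volume of every chart, hence the supremum; its second summand
  -- disappears on restriction to `e.source`.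
  · have h : riemVolume M ≤ chartVolume e + (riemVolume M).restrict e.sourceᶜ := by
      refine iSup₂_le fun e' he' ↦ ?_
      rw [← Measure.restrict_add_restrict_compl (μ := chartVolume e') hms]
      refine add_le_add ?_ (Measure.restrict_mono_measure (hle e' he') _)
      refine Measure.le_iff.2 fun S hS ↦ ?_
      rw [Measure.restrict_apply hS]
      exact (chartVolume_le_of_subset he he' (hS.inter hms) inter_subset_right).trans
        (measure_mono inter_subset_left)
    have h' := Measure.restrict_mono_measure h e.source
    rw [Measure.restrict_add, Measure.restrict_restrict hms, inter_compl_self,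
      Measure.restrict_empty, add_zero, chartVolume_restrict_source] at h'
    exact h'
  · have h := Measure.restrict_mono_measure (hle e he) e.source
    rwa [chartVolume_restrict_source] at h

theorem riemVolume_apply_of_subset (he : e ∈ atlas Plane M) {S : Set M}
    (hS : MeasurableSet S) (hsub : S ⊆ e.source) :
    riemVolume M S =
      ∫⁻ z in e.target ∩ e.symm ⁻¹' S, ENNReal.ofReal (Real.sqrt (gram e z).det) := by
  rw [← chartVolume_apply e hS, ← riemVolume_restrict_source he, Measure.restrict_apply hS,
    inter_eq_left.2 hsub]

variable [IsContMDiffRiemannianBundle (𝓡 2) ∞ Plane (fun x : M ↦ TangentSpace (𝓡 2) x)]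
  [IsRiemannianManifold (𝓡 2) M]

/-- In the chart the ball lies in the ellipse ‖A(z - e x)‖ < r/(1 - ε), and the density is at most
(1 + ε)|det A|. The determinants cancel. This asymptotically sharp bound is the source of the
threshold 4π. -/
theorem exists_ball_volume_le_local (p : M) {ε : ℝ} (hε : 0 < ε) (hε1 : ε < 1) :
    ∃ R > 0, ∀ x ∈ Metric.ball p R, ∀ r, 0 < r → r ≤ R →
      riemVolume M (Metric.ball x r) ≤
        ENNReal.ofReal ((1 + ε) / (1 - ε) ^ 2 * (Real.pi * r ^ 2)) := by
  set e := chartAt Plane p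
  have he : e ∈ atlas Plane M := chart_mem_atlas Plane p
  have hp : p ∈ e.source := mem_chart_source Plane p
  obtain ⟨A, hdet, -, s, hs, hst, hcomp⟩ :=
    exists_local_comparison he (e.map_source hp) hε hε1
  have hU : e.source ∩ e ⁻¹' Metric.ball (e p) s ∈ 𝓝 p :=
    inter_mem (e.open_source.mem_nhds hp)
      ((e.continuousAt hp).preimage_mem_nhds (Metric.ball_mem_nhds _ hs))
  obtain ⟨R, hR, hRU⟩ := Metric.mem_nhds_iff.1 hU
  have h3 : 3 * (R / 3) = R := by ring
  have hε' : 0 < 1 - ε := by linarith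
  -- Centre and radius of size R/6 keep the ball inside radius R/3, as `le_dist_of_ball_subset`
  -- needs with its threefold ball of radius R.
  refine ⟨R / 6, by positivity, fun x hx r hr hrR ↦ ?_⟩
  have hxr : Metric.ball x r ⊆ Metric.ball p (R / 3) := by
    refine Metric.ball_subset_ball' ?_
    rw [Metric.mem_ball] at hx
    linarith
  have hRR : Metric.ball p (R / 3) ⊆ Metric.ball p R := Metric.ball_subset_ball (by linarith)
  rw [riemVolume_apply_of_subset he Metric.isOpen_ball.measurableSet
    fun y hy ↦ (hRU (hRR (hxr hy))).1]
  have hsub : e.target ∩ e.symm ⁻¹' Metric.ball x r ⊆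
      {z | ‖A (z - e x)‖ < r / (1 - ε)} := by
    rintro z ⟨hz, hzx⟩
    have h := le_dist_of_ball_subset he A hε'.le (p := p) (R := R / 3)
      (by rw [h3]; exact fun y hy ↦ (hRU hy).1)
      (by rw [h3]; exact fun y hy v ↦ ((hcomp (e y) (hRU hy).2).1 v).1)
      (hxr hzx) (hxr (Metric.mem_ball_self hr))
    rw [e.right_inv hz] at h
    rw [mem_ofPred_eq, lt_div_iff₀ hε', mul_comm]
    exact h.trans_lt hzx
  have hmeas : MeasurableSet (e.target ∩ e.symm ⁻¹' Metric.ball x r) :=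
    measurableSet_inter_preimage e.continuousOn_symm e.open_target.measurableSet
      Metric.isOpen_ball.measurableSet
  calc _ ≤ ∫⁻ z in e.target ∩ e.symm ⁻¹' Metric.ball x r, ENNReal.ofReal ((1 + ε) * |A.det|) := by
        refine setLIntegral_mono' hmeas fun z hz ↦ ENNReal.ofReal_le_ofReal ?_
        have h := (hRU (hRR (hxr hz.2))).2
        rw [mem_preimage, e.right_inv hz.1] at h
        exact (hcomp z h).2.2
    _ = ENNReal.ofReal ((1 + ε) * |A.det|) * volume (e.target ∩ e.symm ⁻¹' Metric.ball x r) :=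
        setLIntegral_const _ _
    _ ≤ ENNReal.ofReal ((1 + ε) * |A.det|) *
          ENNReal.ofReal (|A.det|⁻¹ * (Real.pi * (r / (1 - ε)) ^ 2)) := by
        rw [← volume_linear_preimage hdet (e x) (by positivity)]
        gcongr
    _ = _ := by
        rw [← ENNReal.ofReal_mul (by positivity)]
        congr 1
        have := abs_pos.2 hdet
        field_simp

/-- Coordinate segments are longer than their ‖A·‖-length by at most a factor 3/2, so the ball
contains the ellipse of size 2r/3. The resulting constant 2π/9 is far above 1/10; no sharpness is
needed, as this bound only enters through a logarithm. -/
theorem exists_le_ball_volume_local (p : M) :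
    ∃ R > 0, ∀ x ∈ Metric.ball p R, ∀ r, 0 < r → r ≤ R →
      ENNReal.ofReal (r ^ 2 / 10) ≤ riemVolume M (Metric.ball x r) := by
  set e := chartAt Plane p
  have he : e ∈ atlas Plane M := chart_mem_atlas Plane p
  have hp : p ∈ e.source := mem_chart_source Plane p
  obtain ⟨A, hdet, -, s, hs, hst, hcomp⟩ :=
    exists_local_comparison he (e.map_source hp) (ε := 1 / 2) (by norm_num) (by norm_num)
  obtain ⟨c, hc, hcA⟩ := exists_mul_norm_sq_le hdet
  have hU : e.source ∩ e ⁻¹' Metric.ball (e p) (s / 2) ∈ 𝓝 p :=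
    inter_mem (e.open_source.mem_nhds hp)
      ((e.continuousAt hp).preimage_mem_nhds (Metric.ball_mem_nhds _ (by positivity)))
  obtain ⟨R, hR, hRU⟩ := Metric.mem_nhds_iff.1 hU
  -- The first bound keeps the ball in the chart neighbourhood; the second keeps the ellipse in the
  -- coordinate ball of radius s, where the comparison holds.
  refine ⟨min (R / 2) (√c * (s / 2)), by positivity, fun x hx r hr hrR ↦ ?_⟩
  have hrR1 := hrR.trans (min_le_left _ _)
  have hrR2 := hrR.trans (min_le_right _ _)
  rw [Metric.mem_ball] at hx
  have hx1 := hx.trans_le (min_le_left _ _)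
  have hxr : Metric.ball x r ⊆ Metric.ball p R := Metric.ball_subset_ball' (by linarith)
  have hxs := hRU (hxr (Metric.mem_ball_self hr))
  rw [riemVolume_apply_of_subset he Metric.isOpen_ball.measurableSet
    fun y hy ↦ (hRU (hxr hy)).1]
  have hball : ∀ z, ‖A (z - e x)‖ < r / (3 / 2) → z ∈ Metric.ball (e p) s := by
    intro z hz
    have h1 := hcA (z - e x)
    have h2 : ‖A (z - e x)‖ < √c * (s / 2) := by
      have : r / (3 / 2) ≤ r := div_le_self hr.le (by norm_num)
      linarith
    have h3 : ‖z - e x‖ < s / 2 := by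
      by_contra! hcon
      have h4 : (√c * (s / 2)) ^ 2 ≤ ‖A (z - e x)‖ ^ 2 := by
        rw [mul_pow, Real.sq_sqrt hc.le]
        refine le_trans ?_ h1
        gcongr
      exact absurd h2 (not_lt.2 (le_of_sq_le_sq h4 (norm_nonneg _)))
    have h4 := hxs.2
    rw [mem_preimage, Metric.mem_ball] at h4
    rw [Metric.mem_ball]
    have h5 := dist_triangle z (e x) (e p)
    rw [dist_eq_norm z (e x)] at h5
    linarith
  have hex : e x ∈ Metric.ball (e p) s := Metric.ball_subset_ball (by linarith) hxs.2
  have hsub : {z | ‖A (z - e x)‖ < r / (3 / 2)} ⊆ e.target ∩ e.symm ⁻¹' Metric.ball x r := by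
    intro z hz
    have hz' := hball z hz
    refine ⟨hst hz', ?_⟩
    have hseg := (convex_ball (e p) s).segment_subset hex hz'
    have h := dist_symm_le he (z := e x) (z' := z) (C := (1 + 1 / 2) * ‖A (z - e x)‖)
      (by positivity) (hseg.trans hst) fun w hw ↦ ((hcomp w (hseg hw)).1 _).2
    rw [e.left_inv hxs.1] at h
    rw [mem_preimage, Metric.mem_ball, dist_comm]
    rw [mem_ofPred_eq, lt_div_iff₀ (by norm_num)] at hz
    linarith
  calc ENNReal.ofReal (r ^ 2 / 10)
      ≤ ENNReal.ofReal ((1 - 1 / 2) * |A.det| * (|A.det|⁻¹ * (Real.pi * (r / (3 / 2)) ^ 2))) := by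
        refine ENNReal.ofReal_le_ofReal ?_
        have := abs_pos.2 hdet
        have h : (1 - 1 / 2) * |A.det| * (|A.det|⁻¹ * (Real.pi * (r / (3 / 2)) ^ 2)) =
          Real.pi * r ^ 2 * (2 / 9) := by field_simp; norm_num
        rw [h]
        nlinarith [Real.pi_gt_three, sq_nonneg r]
    _ = ∫⁻ z in {z | ‖A (z - e x)‖ < r / (3 / 2)}, ENNReal.ofReal ((1 - 1 / 2) * |A.det|) := by
        rw [setLIntegral_const, volume_linear_preimage hdet (e x) (by positivity),
          ← ENNReal.ofReal_mul (by positivity)]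
    _ ≤ ∫⁻ z in {z | ‖A (z - e x)‖ < r / (3 / 2)}, ENNReal.ofReal (Real.sqrt (gram e z).det) := by
        refine setLIntegral_mono' ?_ fun z hz ↦
          ENNReal.ofReal_le_ofReal (hcomp z (hball z hz)).2.1
        exact (isOpen_lt (by fun_prop) continuous_const).measurableSet
    _ ≤ _ := lintegral_mono_set hsub

variable [CompactSpace M]

/-- Small balls have at most the area of Euclidean discs, up to a factor close to one. -/
theorem exists_ball_volume_le {ε : ℝ} (hε : 0 < ε) (hε1 : ε < 1) :
    ∃ R > 0, ∀ x : M, ∀ r, 0 < r → r ≤ R →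
      riemVolume M (Metric.ball x r) ≤
        ENNReal.ofReal ((1 + ε) / (1 - ε) ^ 2 * (Real.pi * r ^ 2)) := by
  have h := isCompact_univ.induction_on (X := M) (p := fun S ↦ ∃ R > 0, ∀ x ∈ S, ∀ r, 0 < r →
      r ≤ R → riemVolume M (Metric.ball x r) ≤
        ENNReal.ofReal ((1 + ε) / (1 - ε) ^ 2 * (Real.pi * r ^ 2))) ⟨1, one_pos, by simp⟩
    (fun s t hst ⟨R, hR, h⟩ ↦ ⟨R, hR, fun x hx ↦ h x (hst hx)⟩)
    (fun s t ⟨R, hR, h⟩ ⟨R', hR', h'⟩ ↦ ⟨min R R', lt_min hR hR', fun x hx r hr hrR ↦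
      hx.elim (fun hx ↦ h x hx r hr (hrR.trans (min_le_left _ _)))
        fun hx ↦ h' x hx r hr (hrR.trans (min_le_right _ _))⟩)
    (fun p _ ↦ by
      obtain ⟨R, hR, h⟩ := exists_ball_volume_le_local p hε hε1
      exact ⟨Metric.ball p R, mem_nhdsWithin_of_mem_nhds (Metric.ball_mem_nhds p hR), R, hR, h⟩)
  obtain ⟨R, hR, h⟩ := h
  exact ⟨R, hR, fun x ↦ h x (mem_univ x)⟩

theorem exists_le_ball_volume :
    ∃ R > 0, ∀ x : M, ∀ r, 0 < r → r ≤ R →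
      ENNReal.ofReal (r ^ 2 / 10) ≤ riemVolume M (Metric.ball x r) := by
  have h := isCompact_univ.induction_on (X := M) (p := fun S ↦ ∃ R > 0, ∀ x ∈ S, ∀ r, 0 < r →
      r ≤ R → ENNReal.ofReal (r ^ 2 / 10) ≤ riemVolume M (Metric.ball x r)) ⟨1, one_pos, by simp⟩
    (fun s t hst ⟨R, hR, h⟩ ↦ ⟨R, hR, fun x hx ↦ h x (hst hx)⟩)
    (fun s t ⟨R, hR, h⟩ ⟨R', hR', h'⟩ ↦ ⟨min R R', lt_min hR hR', fun x hx r hr hrR ↦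
      hx.elim (fun hx ↦ h x hx r hr (hrR.trans (min_le_left _ _)))
        fun hx ↦ h' x hx r hr (hrR.trans (min_le_right _ _))⟩)
    (fun p _ ↦ by
      obtain ⟨R, hR, h⟩ := exists_le_ball_volume_local p
      exact ⟨Metric.ball p R, mem_nhdsWithin_of_mem_nhds (Metric.ball_mem_nhds p hR), R, hR, h⟩)
  obtain ⟨R, hR, h⟩ := h
  exact ⟨R, hR, fun x ↦ h x (mem_univ x)⟩

end Volume

/-! ### Gradients of Lipschitz functions -/

section Gradient

variable {M : Type*} [MetricSpace M] [ChartedSpace Plane M]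

/-- The function `u` in the coordinates of the chart `e`. -/
def inChart (e : OpenPartialHomeomorph M Plane) (u : M → ℝ) (z : Plane) : ℝ := u (e.symm z)

section Manifold

variable [IsManifold (𝓡 2) ∞ M] {e : OpenPartialHomeomorph M Plane} {u : M → ℝ}

theorem mdifferentiableAt_of_inChart (he : e ∈ atlas Plane M) {z : Plane} (hz : z ∈ e.target)
    (h : DifferentiableAt ℝ (inChart e u) z) :
    MDifferentiableAt (𝓡 2) 𝓘(ℝ, ℝ) u (e.symm z) := by
  have hs := e.map_target hz
  have h1 : DifferentiableAt ℝ (inChart e u) (e (e.symm z)) := by rwa [e.right_inv hz]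
  refine (h1.comp_mdifferentiableAt (mdifferentiableAt_chart he hs)).congr_of_eventuallyEq ?_
  filter_upwards [e.open_source.mem_nhds hs] with y hy
  simp [inChart, e.left_inv hy]

theorem differentiableAt_inChart (he : e ∈ atlas Plane M) {z : Plane} (hz : z ∈ e.target)
    (h : MDifferentiableAt (𝓡 2) 𝓘(ℝ, ℝ) u (e.symm z)) :
    DifferentiableAt ℝ (inChart e u) z :=
  (h.comp z (mdifferentiableAt_chart_symm he hz)).differentiableAt

theorem coordVec_surjective (he : e ∈ atlas Plane M) {z : Plane} (hz : z ∈ e.target) :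
    Function.Surjective (coordVec e z) :=
  (coordMap_bijective he hz).2

end Manifold

variable [RiemannianBundle (fun x : M ↦ TangentSpace (𝓡 2) x)]

/-- Riesz representation. For a merely linear functional on `Plane`, the norms of `Plane` and of the
tangent space need not be compared. -/
theorem exists_inner_eq (x : M) (ℓ : Plane →ₗ[ℝ] ℝ) :
    ∃ G : TangentSpace (𝓡 2) x, ∀ w : TangentSpace (𝓡 2) x, inner ℝ G w = ℓ w := by
  have hfin : FiniteDimensional ℝ (TangentSpace (𝓡 2) x) :=
    inferInstanceAs (FiniteDimensional ℝ Plane)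
  have : CompleteSpace (TangentSpace (𝓡 2) x) := FiniteDimensional.complete ℝ _
  let ℓ' : TangentSpace (𝓡 2) x →ₗ[ℝ] ℝ := ℓ
  refine ⟨(InnerProductSpace.toDual ℝ (TangentSpace (𝓡 2) x)).symm
    (LinearMap.toContinuousLinearMap ℓ'), fun w ↦ ?_⟩
  rw [InnerProductSpace.toDual_symm_apply]
  rfl

/-- The pointwise gradient of a function, dual to its differential. It is zero where the function
is not differentiable. -/
def ptGrad (u : M → ℝ) (x : M) : TangentSpace (𝓡 2) x :=
  (exists_inner_eq x
    (show Plane →L[ℝ] ℝ from mfderiv (𝓡 2) 𝓘(ℝ, ℝ) u x : Plane →ₗ[ℝ] ℝ)).choose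

theorem inner_ptGrad (u : M → ℝ) (x : M) (w : TangentSpace (𝓡 2) x) :
    inner ℝ (ptGrad u x) w = mfderiv (𝓡 2) 𝓘(ℝ, ℝ) u x w :=
  (exists_inner_eq x
    (show Plane →L[ℝ] ℝ from mfderiv (𝓡 2) 𝓘(ℝ, ℝ) u x : Plane →ₗ[ℝ] ℝ)).choose_spec w

theorem ptGrad_of_not_mdifferentiableAt {u : M → ℝ} {x : M}
    (h : ¬ MDifferentiableAt (𝓡 2) 𝓘(ℝ, ℝ) u x) : ptGrad u x = 0 := by
  refine ext_inner_right ℝ fun w ↦ ?_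
  rw [inner_ptGrad, mfderiv_zero_of_not_mdifferentiableAt h, inner_zero_left]
  rfl

theorem ptGrad_add_smul {u w : M → ℝ} {x : M} (c : ℝ)
    (hu : MDifferentiableAt (𝓡 2) 𝓘(ℝ, ℝ) u x) (hw : MDifferentiableAt (𝓡 2) 𝓘(ℝ, ℝ) w x) :
    ptGrad (fun y ↦ u y + c * w y) x = ptGrad u x + c • ptGrad w x := by
  refine ext_inner_right ℝ fun v ↦ ?_
  rw [inner_add_left, real_inner_smul_left, inner_ptGrad, inner_ptGrad, inner_ptGrad]
  have h := (hu.hasMFDerivAt.add ((hw.hasMFDerivAt).const_smul c)).mfderiv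
  exact congrArg (fun f : Plane →L[ℝ] ℝ ↦ f v) h

variable [IsManifold (𝓡 2) ∞ M] {e : OpenPartialHomeomorph M Plane} {u : M → ℝ}

theorem inner_ptGrad_coordVec (he : e ∈ atlas Plane M) {z : Plane} (hz : z ∈ e.target)
    (h : DifferentiableAt ℝ (inChart e u) z) (v : Plane) :
    inner ℝ (ptGrad u (e.symm z)) (coordVec e z v) = fderiv ℝ (inChart e u) z v := by
  rw [inner_ptGrad]
  have h1 := mfderiv_comp z (mdifferentiableAt_of_inChart he hz h)
    (mdifferentiableAt_chart_symm he hz)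
  have h2 : mfderiv (𝓡 2) 𝓘(ℝ, ℝ) (u ∘ e.symm) z = fderiv ℝ (inChart e u) z := mfderiv_eq_fderiv
  rw [h2] at h1
  exact (congrArg (fun f : Plane →L[ℝ] ℝ ↦ f v) h1).symm

/-- The norm of a tangent vector in terms of its products with the coordinate vectors. -/
theorem norm_sq_eq_gram (he : e ∈ atlas Plane M) {z : Plane} (hz : z ∈ e.target)
    (G : TangentSpace (𝓡 2) (e.symm z)) {p q : ℝ}
    (hp : inner ℝ G (coordVec e z (EuclideanSpace.single 0 1)) = p)
    (hq : inner ℝ G (coordVec e z (EuclideanSpace.single 1 1)) = q) :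
    ‖G‖ ^ 2 = (gram e z 1 1 * p ^ 2 - 2 * gram e z 0 1 * p * q + gram e z 0 0 * q ^ 2) /
      (gram e z).det := by
  obtain ⟨v, rfl⟩ := coordVec_surjective he hz G
  rw [inner_coordVec, chartMetric_eq_gram] at hp hq
  rw [eq_div_iff (gram_det_pos he hz).ne']
  have h := chartNorm_sq e z v
  unfold chartNorm at h
  have h10 : gram e z 1 0 = gram e z 0 1 := chartMetric_comm _ _ _ _
  rw [h, chartMetric_eq_gram, Matrix.det_fin_two, h10, ← hp, ← hq]
  simp
  ring

variable [IsContMDiffRiemannianBundle (𝓡 2) ∞ Plane (fun x : M ↦ TangentSpace (𝓡 2) x)]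
  [IsRiemannianManifold (𝓡 2) M]

/-- The gradient is bounded by the pointwise Lipschitz constant. -/
theorem norm_ptGrad_le {x : M} {L : ℝ} (hL : 0 ≤ L)
    (h : ∀ L' > L, ∀ᶠ y in 𝓝 x, |u y - u x| ≤ L' * dist y x) : ‖ptGrad u x‖ ≤ L := by
  by_cases hd : MDifferentiableAt (𝓡 2) 𝓘(ℝ, ℝ) u x
  swap
  · rwa [ptGrad_of_not_mdifferentiableAt hd, norm_zero]
  obtain ⟨e, he, z, hz, rfl⟩ : ∃ e ∈ atlas Plane M, ∃ z ∈ e.target, e.symm z = x :=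
    ⟨chartAt Plane x, chart_mem_atlas Plane x, chartAt Plane x x, mem_chart_target Plane x,
      (chartAt Plane x).left_inv (mem_chart_source Plane x)⟩
  have hd' := differentiableAt_inChart he hz hd
  -- The derivative is taken in the direction of the gradient itself, along the coordinate line z +
  -- tv, where it equals ‖∇u‖².
  obtain ⟨v, hv⟩ := coordVec_surjective he hz (ptGrad u (e.symm z))
  have key : ∀ ε > 0, ε < 1 →
      |fderiv ℝ (inChart e u) z v| ≤ (L + ε) * ((1 + ε) * chartNorm e z v) := by
    intro ε hε hε1
    obtain ⟨A, -, hA, s, hs, hst, hcomp⟩ := exists_local_comparison he hz hε hε1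
    have hline : HasDerivAt (fun t : ℝ ↦ inChart e u (z + t • v))
        (fderiv ℝ (inChart e u) z v) 0 := by
      have h1 : HasDerivAt (fun t : ℝ ↦ z + t • v) v 0 := by
        simpa using ((hasDerivAt_id (0 : ℝ)).smul_const v).const_add z
      have h2 : HasFDerivAt (inChart e u) (fderiv ℝ (inChart e u) z) (z + (0 : ℝ) • v) := by
        simpa using hd'.hasFDerivAt
      exact h2.comp_hasDerivAt (0 : ℝ) h1
    refine hline.le_of_lip' (mul_nonneg (by positivity)
      (mul_nonneg (by positivity) (chartNorm_nonneg _ _ _))) ?_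
    have hc : ContinuousAt (fun t : ℝ ↦ z + t • v) 0 := by fun_prop
    have hcz : z + (0 : ℝ) • v = z := by simp
    have e1 : ∀ᶠ t : ℝ in 𝓝 0, z + t • v ∈ Metric.ball z s := by
      refine hc.eventually_mem ?_
      rw [hcz]
      exact Metric.ball_mem_nhds z hs
    have e2 : ∀ᶠ t : ℝ in 𝓝 0, |u (e.symm (z + t • v)) - u (e.symm z)| ≤
        (L + ε) * dist (e.symm (z + t • v)) (e.symm z) := by
      have hce : ContinuousAt (fun t : ℝ ↦ e.symm (z + t • v)) 0 :=
        ContinuousAt.comp (g := e.symm) (by rw [hcz]; exact e.continuousAt_symm hz) hc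
      have := h (L + ε) (by linarith)
      rw [show e.symm z = e.symm (z + (0 : ℝ) • v) by simp] at this
      have := hce.eventually this
      simpa using this
    filter_upwards [e1, e2] with t ht1 ht2
    have hseg := (convex_ball z s).segment_subset (Metric.mem_ball_self hs) ht1
    have hdist := dist_symm_le he (z := z) (z' := z + t • v)
      (C := (1 + ε) * ‖A (z + t • v - z)‖) (by positivity) (hseg.trans hst)
      fun w hw ↦ ((hcomp w (hseg hw)).1 _).2
    rw [add_sub_cancel_left, map_smul, norm_smul, ← hA] at hdist
    simp only [inChart, zero_smul, add_zero, sub_zero]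
    rw [Real.norm_eq_abs]
    rw [dist_comm] at ht2
    calc _ ≤ _ := ht2
      _ ≤ (L + ε) * ((1 + ε) * (‖t‖ * chartNorm e z v)) := by gcongr
      _ = _ := by ring
  have key2 : |fderiv ℝ (inChart e u) z v| ≤ L * chartNorm e z v := by
    have ht : Tendsto (fun ε : ℝ ↦ (L + ε) * ((1 + ε) * chartNorm e z v)) (𝓝[>] 0)
        (𝓝 ((L + 0) * ((1 + 0) * chartNorm e z v))) := by
      refine Tendsto.mono_left ?_ nhdsWithin_le_nhds
      exact Continuous.tendsto (by fun_prop) 0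
    rw [add_zero, add_zero, one_mul] at ht
    refine ge_of_tendsto ht ?_
    filter_upwards [Ioo_mem_nhdsGT (zero_lt_one (α := ℝ))] with ε hε
    exact key ε hε.1 hε.2
  -- The bound now reads ‖∇u‖² ≤ L‖∇u‖.
  rw [← inner_ptGrad_coordVec he hz hd', hv, real_inner_self_eq_norm_sq, chartNorm, hv] at key2
  rw [abs_of_nonneg (by positivity)] at key2
  by_contra! hcon
  nlinarith [norm_nonneg (ptGrad u (e.symm z))]

theorem norm_ptGrad_le_of_lipschitz {K : NNReal} (hu : LipschitzWith K u) (x : M) :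
    ‖ptGrad u x‖ ≤ K := by
  refine norm_ptGrad_le K.2 fun L' hL' ↦ Eventually.of_forall fun y ↦ ?_
  have := hu.dist_le_mul y x
  rw [Real.dist_eq] at this
  refine this.trans ?_
  gcongr

theorem locallyLipschitzOn_inChart {K : NNReal} (hu : LipschitzWith K u)
    (he : e ∈ atlas Plane M) {z : Plane} (hz : z ∈ e.target) :
    ∃ C, ∃ s > 0, Metric.ball z s ⊆ e.target ∧ LipschitzOnWith C (inChart e u) (Metric.ball z s) := by
  obtain ⟨A, -, -, s, hs, hst, hcomp⟩ :=
    exists_local_comparison he hz (ε := 1 / 2) (by norm_num) (by norm_num)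
  refine ⟨K * (2 * ‖A‖₊), s, hs, hst, LipschitzOnWith.of_dist_le_mul fun w hw w' hw' ↦ ?_⟩
  have hseg := (convex_ball z s).segment_subset hw hw'
  have hdist := dist_symm_le he (z := w) (z' := w')
    (C := (1 + 1 / 2) * ‖A (w' - w)‖) (by positivity) (hseg.trans hst)
    fun y hy ↦ ((hcomp y (hseg hy)).1 _).2
  refine (hu.dist_le_mul _ _).trans ?_
  push_cast
  rw [mul_assoc]
  gcongr
  refine hdist.trans ?_
  have h1 := A.le_opNorm (w' - w)
  rw [dist_comm, dist_eq_norm]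
  nlinarith [norm_nonneg (A (w' - w))]

/-- Rademacher's theorem on small coordinate balls, where the function is Lipschitz; being null is a
local property. -/
theorem ae_differentiableAt_inChart {K : NNReal} (hu : LipschitzWith K u)
    (he : e ∈ atlas Plane M) :
    ∀ᵐ z, z ∈ e.target → DifferentiableAt ℝ (inChart e u) z := by
  rw [ae_iff]
  refine measure_null_of_locally_null _ fun z hz ↦ ?_
  have hz' : z ∈ e.target := by
    by_contra h
    exact hz fun h' ↦ absurd h' h
  obtain ⟨C, s, hs, hst, hlip⟩ := locallyLipschitzOn_inChart hu he hz'
  refine ⟨Metric.ball z s ∩ {z | ¬(z ∈ e.target → DifferentiableAt ℝ (inChart e u) z)},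
    inter_mem (mem_nhdsWithin_of_mem_nhds (Metric.ball_mem_nhds z hs)) self_mem_nhdsWithin, ?_⟩
  have h := hlip.ae_differentiableWithinAt_of_mem (μ := volume)
  rw [ae_iff] at h
  refine measure_mono_null ?_ h
  rintro w ⟨hw, hw'⟩ hcon
  exact hw' fun _ ↦ (hcon hw).differentiableAt (Metric.isOpen_ball.mem_nhds hw)

theorem ae_inner_ptGrad_coordVec {K : NNReal} (hu : LipschitzWith K u) (he : e ∈ atlas Plane M)
    (v : Plane) :
    (fun z ↦ inner ℝ (ptGrad u (e.symm z)) (coordVec e z v)) =ᵐ[volume.restrict e.target]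
      fun z ↦ fderiv ℝ (inChart e u) z v := by
  refine (ae_restrict_iff' e.open_target.measurableSet).2 ?_
  filter_upwards [ae_differentiableAt_inChart hu he] with z hz hz'
  exact inner_ptGrad_coordVec he hz' (hz hz') v

/-- By Rademacher the pairing with a coordinate vector is almost everywhere a coordinate derivative;
the identity is then integration by parts for Lipschitz functions on the plane. -/
theorem isWeakGradient_ptGrad {K : NNReal} (hu : LipschitzWith K u) :
    IsWeakGradient u (ptGrad u) := by
  intro e he
  have hms := e.open_target.measurableSet
  refine ⟨(hu.continuous.comp_continuousOn e.continuousOn_symm).locallyIntegrableOn hms,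
    fun v ↦ ⟨?_, fun η hη hsupp hsub ↦ ?_⟩⟩
  · have h1 : LocallyIntegrableOn (fun z ↦ (K : ℝ) * chartNorm e z v) e.target :=
      (continuousOn_const.mul (continuousOn_chartNorm he v)).locallyIntegrableOn hms
    have h2 : LocallyIntegrableOn
        (e.target.indicator fun z ↦ fderiv ℝ (inChart e u) z v) e.target := by
      refine h1.mono ((measurable_fderiv_apply_const ℝ _ v).indicator
        hms).aestronglyMeasurable ?_
      filter_upwards [ae_differentiableAt_inChart hu he] with z hz
      by_cases hzt : z ∈ e.target
      · rw [indicator_of_mem hzt, ← inner_ptGrad_coordVec he hzt (hz hzt)]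
        refine (norm_inner_le_norm _ _).trans (le_trans ?_ (Real.le_norm_self _))
        exact mul_le_mul_of_nonneg_right (norm_ptGrad_le_of_lipschitz hu _) (norm_nonneg _)
      · rw [indicator_of_notMem hzt, norm_zero]
        exact norm_nonneg _
    refine h2.congr ?_
    refine EventuallyEq.trans ?_ (ae_inner_ptGrad_coordVec hu he v).symm
    exact indicator_ae_eq_restrict hms
  -- Integration by parts requires a globally Lipschitz function. The function is Lipschitz on a
  -- compact neighbourhood `S` of the support of `η` and is extended from there; only values near
  -- this support matter.
  · obtain ⟨S, hS, hKS, hSt⟩ := exists_compact_between hsupp e.open_target hsub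
    have hloc : LocallyLipschitzOn S (inChart e u) := fun z hz ↦ by
      obtain ⟨C, s, hs, -, hlip⟩ := locallyLipschitzOn_inChart hu he (hSt hz)
      exact ⟨C, Metric.ball z s, mem_nhdsWithin_of_mem_nhds (Metric.ball_mem_nhds z hs), hlip⟩
    obtain ⟨C, hC⟩ := hloc.exists_lipschitzOnWith_of_compact hS
    obtain ⟨f, hf, hfeq⟩ := hC.extend_real
    obtain ⟨D, hD⟩ := hη.lipschitzWith_of_hasCompactSupport hsupp (by simp)
    have hibp := hf.integral_lineDeriv_mul_eq (μ := volume) hD hsupp v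
    have hdη : ∀ z, lineDeriv ℝ η z (-v) = -fderiv ℝ η z v := fun z ↦ by
      rw [((hη.differentiable (by simp)) z).lineDeriv_eq_fderiv, map_neg]
    have hl : ∫ z in e.target, u (e.symm z) * fderiv ℝ η z v = ∫ z, f z * fderiv ℝ η z v := by
      rw [setIntegral_eq_integral_of_forall_compl_eq_zero]
      · refine integral_congr_ae (Eventually.of_forall fun z ↦ ?_)
        by_cases hz : z ∈ tsupport η
        · have := hfeq (interior_subset (hKS hz))
          simp only [← this, inChart]
        · simp [fderiv_of_notMem_tsupport ℝ hz]
      · intro z hz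
        simp [fderiv_of_notMem_tsupport ℝ fun h ↦ hz (hsub h)]
    have hr : ∫ z in e.target, inner ℝ (ptGrad u (e.symm z)) (coordVec e z v) * η z =
        ∫ z, lineDeriv ℝ f z v * η z := by
      rw [setIntegral_eq_integral_of_forall_compl_eq_zero]
      · refine integral_congr_ae ?_
        filter_upwards [ae_differentiableAt_inChart hu he] with z hz
        by_cases hzs : z ∈ tsupport η
        · have hzt := hsub hzs
          have heq : f =ᶠ[𝓝 z] inChart e u := by
            filter_upwards [isOpen_interior.mem_nhds (hKS hzs)] with w hw
            exact (hfeq (interior_subset hw)).symm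
          rw [inner_ptGrad_coordVec he hzt (hz hzt), heq.lineDeriv_eq,
            (hz hzt).lineDeriv_eq_fderiv]
        · simp [image_eq_zero_of_notMem_tsupport hzs]
      · intro z hz
        simp [image_eq_zero_of_notMem_tsupport fun h ↦ hz (hsub h)]
    rw [hl, hr, hibp, ← integral_neg]
    refine integral_congr_ae (Eventually.of_forall fun z ↦ ?_)
    simp only [hdη]
    ring

end Gradient

/-! ### Weak gradients -/

section WeakGradient

variable {M : Type*} [MetricSpace M] [ChartedSpace Plane M]

theorem exists_finset_charts [CompactSpace M] :
    ∃ t : Finset M, ⋃ x : t, (chartAt Plane (x : M)).source = univ := by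
  obtain ⟨t, ht⟩ := isCompact_univ.elim_finite_subcover
    (fun x : M ↦ (chartAt Plane x).source) (fun x ↦ (chartAt Plane x).open_source)
    fun x _ ↦ mem_iUnion.2 ⟨x, mem_chart_source Plane x⟩
  refine ⟨t, eq_univ_of_univ_subset fun x hx ↦ ?_⟩
  obtain ⟨y, hy, hxy⟩ := mem_iUnion₂.1 (ht hx)
  exact mem_iUnion.2 ⟨⟨y, hy⟩, hxy⟩

variable [RiemannianBundle (fun x : M ↦ TangentSpace (𝓡 2) x)]

section

variable [MeasurableSpace M] [BorelSpace M]

theorem ae_chartVolume_of_ae {e : OpenPartialHomeomorph M Plane} {P : M → Prop}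
    (h : ∀ᵐ z ∂(volume.restrict e.target), P (e.symm z)) : ∀ᵐ x ∂(chartVolume e), P x := by
  rw [ae_restrict_iff' e.open_target.measurableSet, ae_iff] at h
  -- `P` need not be measurable, so the exceptional set is enlarged to a measurable null set.
  set N := toMeasurable volume {z | ¬(z ∈ e.target → P (e.symm z))}
  have hN : volume N = 0 := by rw [measure_toMeasurable, h]
  have hNm : MeasurableSet N := measurableSet_toMeasurable _ _
  have hS : MeasurableSet (e.source ∩ e ⁻¹' N) :=
    measurableSet_inter_preimage e.continuousOn e.open_source.measurableSet hNm
  have h0 : chartVolume e (e.source ∩ e ⁻¹' N) = 0 := by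
    rw [chartVolume_apply e hS]
    refine setLIntegral_measure_zero _ _ (measure_mono_null ?_ hN)
    rintro z ⟨hz, -, hzN⟩
    rwa [mem_preimage, e.right_inv hz] at hzN
  rw [ae_iff]
  refine measure_mono_null ?_ (measure_union_null h0 (chartVolume_compl_source e))
  intro x hx
  by_cases hxs : x ∈ e.source
  · refine Or.inl ⟨hxs, subset_toMeasurable _ _ ?_⟩
    simp only [mem_ofPred_eq, e.left_inv hxs, Classical.not_imp]
    exact ⟨e.map_source hxs, hx⟩
  · exact Or.inr hxs

end

variable [IsManifold (𝓡 2) ∞ M]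

/-- Weak gradients are unique in every chart. -/
theorem IsWeakGradient.ae_eq_inChart {u : M → ℝ} {G G' : ∀ x : M, TangentSpace (𝓡 2) x}
    (h : IsWeakGradient u G) (h' : IsWeakGradient u G') {e : OpenPartialHomeomorph M Plane}
    (he : e ∈ atlas Plane M) :
    ∀ᵐ z ∂(volume.restrict e.target), G (e.symm z) = G' (e.symm z) := by
  -- Fundamental lemma of the calculus of variations, applied to the difference of the pairings with
  -- a coordinate vector.
  have key : ∀ v : Plane, ∀ᵐ z, z ∈ e.target → inner ℝ (G (e.symm z)) (coordVec e z v) -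
      inner ℝ (G' (e.symm z)) (coordVec e z v) = 0 := by
    intro v
    obtain ⟨hi, hη⟩ := (h e he).2 v
    obtain ⟨hi', hη'⟩ := (h' e he).2 v
    refine e.open_target.ae_eq_zero_of_integral_contDiff_smul_eq_zero (hi.sub hi') ?_
    intro η hc hs ht
    have hloc : ∀ f : Plane → ℝ, LocallyIntegrableOn f e.target →
        IntegrableOn (fun z ↦ f z * η z) (tsupport η) := fun f hf ↦
      (hf.integrableOn_compact_subset ht hs).mul_continuousOn hc.continuous.continuousOn hs
    have hint : ∀ f : Plane → ℝ, ∫ z in e.target, f z * η z = ∫ z in tsupport η, f z * η z := by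
      intro f
      rw [setIntegral_eq_of_subset_of_forall_sdiff_eq_zero e.open_target.measurableSet ht]
      rintro z ⟨-, hz⟩
      simp [image_eq_zero_of_notMem_tsupport hz]
    have heq := (hη η hc hs ht).symm.trans (hη' η hc hs ht)
    rw [neg_inj, hint, hint] at heq
    rw [← setIntegral_eq_integral_of_forall_compl_eq_zero (s := tsupport η)]
    · simp only [smul_eq_mul, mul_comm (η _), sub_mul]
      rw [integral_sub (hloc _ hi) (hloc _ hi'), heq, sub_self]
    · intro z hz
      simp [image_eq_zero_of_notMem_tsupport hz]
  refine (ae_restrict_iff' e.open_target.measurableSet).2 ?_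
  filter_upwards [key (EuclideanSpace.single 0 1), key (EuclideanSpace.single 1 1)]
    with z h0 h1 hz
  refine ext_inner_right ℝ fun w ↦ ?_
  obtain ⟨v, rfl⟩ := coordVec_surjective he hz w
  rw [plane_eq v, coordVec_add, coordVec_smul, coordVec_smul, inner_add_right, inner_add_right,
    real_inner_smul_right, real_inner_smul_right, real_inner_smul_right, real_inner_smul_right,
    sub_eq_zero.1 (h0 hz), sub_eq_zero.1 (h1 hz)]

variable [MeasurableSpace M] [BorelSpace M] [CompactSpace M]

theorem ae_riemVolume_of_charts {P : M → Prop}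
    (h : ∀ e ∈ atlas Plane M, ∀ᵐ z ∂(volume.restrict e.target), P (e.symm z)) :
    ∀ᵐ x ∂(riemVolume M), P x := by
  obtain ⟨t, ht⟩ := exists_finset_charts (M := M)
  rw [← Measure.restrict_univ (μ := riemVolume M), ← ht, ae_restrict_iUnion_iff]
  intro x
  rw [riemVolume_restrict_source (chart_mem_atlas Plane (x : M))]
  exact ae_chartVolume_of_ae (h _ (chart_mem_atlas Plane (x : M)))

theorem aemeasurable_riemVolume_of_charts {F : M → ℝ}
    (h : ∀ e ∈ atlas Plane M, AEMeasurable (fun z ↦ F (e.symm z)) (volume.restrict e.target)) :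
    AEMeasurable F (riemVolume M) := by
  obtain ⟨t, ht⟩ := exists_finset_charts (M := M)
  rw [← Measure.restrict_univ (μ := riemVolume M), ← ht, aemeasurable_iUnion_iff]
  intro x
  set e := chartAt Plane (x : M)
  have he : e ∈ atlas Plane M := chart_mem_atlas Plane (x : M)
  obtain ⟨H, hH, hFH⟩ := h e he
  have h1 : AEMeasurable (fun y ↦ H (e y)) ((riemVolume M).restrict e.source) :=
    hH.comp_aemeasurable (e.continuousOn.aemeasurable e.open_source.measurableSet)
  refine h1.congr ?_
  rw [riemVolume_restrict_source he]
  refine ae_chartVolume_of_ae ?_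
  filter_upwards [hFH, ae_restrict_mem e.open_target.measurableSet] with z hz hzt
  rw [e.right_inv hzt, hz]

theorem IsWeakGradient.ae_eq {u : M → ℝ} {G G' : ∀ x : M, TangentSpace (𝓡 2) x}
    (h : IsWeakGradient u G) (h' : IsWeakGradient u G') :
    ∀ᵐ x ∂(riemVolume M), G x = G' x :=
  ae_riemVolume_of_charts fun _ he ↦ h.ae_eq_inChart h' he

variable [IsContMDiffRiemannianBundle (𝓡 2) ∞ Plane (fun x : M ↦ TangentSpace (𝓡 2) x)]
  [IsRiemannianManifold (𝓡 2) M] {u : M → ℝ} {K : NNReal}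

/-- Rademacher's theorem on a surface. -/
theorem ae_mdifferentiableAt (hu : LipschitzWith K u) :
    ∀ᵐ x ∂(riemVolume M), MDifferentiableAt (𝓡 2) 𝓘(ℝ, ℝ) u x := by
  refine ae_riemVolume_of_charts fun e he ↦ ?_
  refine (ae_restrict_iff' e.open_target.measurableSet).2 ?_
  filter_upwards [ae_differentiableAt_inChart hu he] with z hz hzt
  exact mdifferentiableAt_of_inChart he hzt (hz hzt)

/-- `ptGrad` is chosen point by point, but by `norm_sq_eq_gram` its norm is an explicit expression
in the Gram matrix and the coordinate derivatives, which are measurable. -/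
theorem aemeasurable_norm_ptGrad (hu : LipschitzWith K u) :
    AEMeasurable (fun x ↦ ‖ptGrad u x‖) (riemVolume M) := by
  refine aemeasurable_riemVolume_of_charts fun e he ↦ ?_
  have hms := e.open_target.measurableSet
  have hg : ∀ i j, AEMeasurable (fun z ↦ gram e z i j) (volume.restrict e.target) := fun i j ↦
    (continuousOn_gram he i j).aemeasurable hms
  have hd : ∀ v, AEMeasurable (fun z ↦ fderiv ℝ (inChart e u) z v) (volume.restrict e.target) :=
    fun v ↦ (measurable_fderiv_apply_const ℝ _ v).aemeasurable
  have h1 := hd (EuclideanSpace.single 0 1)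
  have h2 := hd (EuclideanSpace.single 1 1)
  have hF : AEMeasurable (fun z ↦ √((gram e z 1 1 *
      fderiv ℝ (inChart e u) z (EuclideanSpace.single 0 1) ^ 2 -
      2 * gram e z 0 1 * fderiv ℝ (inChart e u) z (EuclideanSpace.single 0 1) *
        fderiv ℝ (inChart e u) z (EuclideanSpace.single 1 1) +
      gram e z 0 0 * fderiv ℝ (inChart e u) z (EuclideanSpace.single 1 1) ^ 2) /
        (gram e z).det)) (volume.restrict e.target) := by
    refine AEMeasurable.sqrt (AEMeasurable.div ?_
      ((continuousOn_gram_det he).aemeasurable hms))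
    exact ((((hg 1 1).mul (h1.pow_const 2)).sub ((((hg 0 1).const_mul 2).mul h1).mul h2)).add
      ((hg 0 0).mul (h2.pow_const 2)))
  refine hF.congr ?_
  filter_upwards [ae_inner_ptGrad_coordVec hu he (EuclideanSpace.single 0 1),
    ae_inner_ptGrad_coordVec hu he (EuclideanSpace.single 1 1), ae_restrict_mem hms]
    with z hz1 hz2 hzt
  rw [← norm_sq_eq_gram he hzt _ hz1 hz2, Real.sqrt_sq (norm_nonneg _)]

variable [IsFiniteMeasure (riemVolume M)]

theorem hasL2Gradient_ptGrad (hu : LipschitzWith K u) : HasL2Gradient u (ptGrad u) := by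
  refine ⟨isWeakGradient_ptGrad hu, MemLp.of_bound
    (aemeasurable_norm_ptGrad hu).aestronglyMeasurable K (Eventually.of_forall fun x ↦ ?_)⟩
  rw [norm_norm]
  exact norm_ptGrad_le_of_lipschitz hu x

theorem memH1_of_lipschitz (hu : LipschitzWith K u) : MemH1 u := by
  refine ⟨?_, _, hasL2Gradient_ptGrad hu⟩
  obtain ⟨C, hC⟩ := isCompact_univ.exists_bound_of_continuousOn hu.continuous.continuousOn
  exact MemLp.of_bound hu.continuous.measurable.aestronglyMeasurable C
    (Eventually.of_forall fun x ↦ hC x (mem_univ x))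

/-- `grad` is an arbitrary choice of weak gradient; uniqueness identifies it with the computable
one. -/
theorem ae_grad_eq (hu : LipschitzWith K u) :
    ∀ᵐ x ∂(riemVolume M), grad u x = ptGrad u x := by
  have h : ∃ G, HasL2Gradient u G := ⟨_, hasL2Gradient_ptGrad hu⟩
  have hg : grad u = h.choose := dif_pos h
  rw [hg]
  exact h.choose_spec.1.ae_eq (isWeakGradient_ptGrad hu)

end WeakGradient

/-! ### Integrals of functions of the distance -/

/-- The function `log (1 + t² d(x, y)²)` of `y`. -/
def logBump {M : Type*} [MetricSpace M] (t : ℝ) (x y : M) : ℝ := Real.log (1 + t ^ 2 * dist x y ^ 2)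

/-- The derivative `2 t² r / (1 + t² r²)` of `log (1 + t² r²)`. -/
def radialSlope (t r : ℝ) : ℝ := 2 * t ^ 2 * r / (1 + t ^ 2 * r ^ 2)

theorem one_add_pos (t r : ℝ) : 0 < 1 + t ^ 2 * r ^ 2 := by positivity

theorem hasDerivAt_log_one_add (t r : ℝ) :
    HasDerivAt (fun r ↦ Real.log (1 + t ^ 2 * r ^ 2)) (radialSlope t r) r := by
  have h := (((hasDerivAt_pow 2 r).const_mul (t ^ 2)).const_add 1).log (one_add_pos t r).ne'
  convert h using 1
  simp [radialSlope]
  ring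

theorem radialSlope_nonneg (t : ℝ) {r : ℝ} (hr : 0 ≤ r) : 0 ≤ radialSlope t r := by
  unfold radialSlope
  positivity

/-- This is 2t|r| ≤ 1 + t²r². -/
theorem abs_radialSlope_le {t : ℝ} (ht : 0 ≤ t) (r : ℝ) : |radialSlope t r| ≤ t := by
  rw [radialSlope, abs_div, abs_of_pos (one_add_pos t r), div_le_iff₀ (one_add_pos t r), abs_mul,
    abs_of_nonneg (by positivity : 0 ≤ 2 * t ^ 2)]
  have h := mul_nonneg ht (sq_nonneg (t * |r| - 1))
  rw [← sq_abs r]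
  nlinarith

theorem radialSlope_le_div (t : ℝ) {r : ℝ} (hr : 0 ≤ r) : radialSlope t r ≤ 2 * (1 / r) := by
  rcases hr.eq_or_lt with rfl | hr
  · simp [radialSlope]
  rw [radialSlope, div_le_iff₀ (one_add_pos t r)]
  field_simp
  nlinarith

section Integrals

variable {M : Type*} [MetricSpace M]

theorem continuous_logBump (t : ℝ) (x : M) : Continuous (logBump t x) :=
  Continuous.log (by fun_prop) fun y ↦ (one_add_pos t (dist x y)).ne'

theorem lipschitzWith_logBump {t : ℝ} (ht : 0 ≤ t) (x : M) :
    LipschitzWith t.toNNReal (logBump t x) := by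
  have h : LipschitzWith t.toNNReal fun r : ℝ ↦ Real.log (1 + t ^ 2 * r ^ 2) := by
    refine lipschitzWith_of_nnnorm_deriv_le
      (fun r ↦ (hasDerivAt_log_one_add t r).differentiableAt) fun r ↦ ?_
    rw [(hasDerivAt_log_one_add t r).deriv]
    rw [← NNReal.coe_le_coe, Real.coe_toNNReal t ht]
    exact abs_radialSlope_le ht r
  have h2 := h.comp (LipschitzWith.dist_right x)
  rwa [mul_one] at h2

/-- A substitute for the chain rule: the distance is 1-Lipschitz and the radial profile has
nonnegative slope. Differentiability of the distance, which fails at `x` and may fail elsewhere, is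
not needed. -/
theorem eventually_abs_logBump_sub_le (t : ℝ) (x y : M) {L : ℝ}
    (hL : radialSlope t (dist x y) < L) :
    ∀ᶠ y' in 𝓝 y, |logBump t x y' - logBump t x y| ≤ L * dist y' y := by
  have h := (hasDerivAt_log_one_add t (dist x y)).isLittleO.def (sub_pos.2 hL)
  have hc : Tendsto (fun y' ↦ dist x y') (𝓝 y) (𝓝 (dist x y)) :=
    Continuous.tendsto (by fun_prop) y
  filter_upwards [hc.eventually h] with y' hy'
  have h1 : |dist x y' - dist x y| ≤ dist y' y := by
    rw [dist_comm x y', dist_comm x y]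
    exact abs_dist_sub_le y' y x
  have h2 := radialSlope_nonneg t (dist_nonneg (x := x) (y := y))
  rw [Real.norm_eq_abs, Real.norm_eq_abs, smul_eq_mul] at hy'
  have h3 : logBump t x y' - logBump t x y = (logBump t x y' - logBump t x y -
      (dist x y' - dist x y) * radialSlope t (dist x y)) +
      (dist x y' - dist x y) * radialSlope t (dist x y) := by ring
  rw [h3]
  refine (abs_add_le _ _).trans ?_
  rw [abs_mul, abs_of_nonneg h2]
  calc _ ≤ (L - radialSlope t (dist x y)) * |dist x y' - dist x y| +
        |dist x y' - dist x y| * radialSlope t (dist x y) := add_le_add hy' le_rfl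
    _ = L * |dist x y' - dist x y| := by ring
    _ ≤ _ := by
      have : 0 ≤ L := h2.trans hL.le
      gcongr

/-- The cross term of the energy. -/
theorem radialSlope_mul_le {C₀ c₀ : ℝ} (hC₀ : 0 ≤ C₀) (hc₀ : 0 < c₀) {t₁ t₂ : ℝ} (ht₁ : 0 ≤ t₁)
    (ht₂ : 0 ≤ t₂) {x₁ x₂ : M} (hsep : t₁ ≤ C₀ ∨ t₂ ≤ C₀ ∨ c₀ ≤ dist x₁ x₂) (y : M) :
    radialSlope t₁ (dist x₁ y) * radialSlope t₂ (dist x₂ y) ≤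
      (2 * C₀ + 8 / c₀) * (1 / dist x₁ y + 1 / dist x₂ y) := by
  have n1 := radialSlope_nonneg t₁ (dist_nonneg (x := x₁) (y := y))
  have n2 := radialSlope_nonneg t₂ (dist_nonneg (x := x₂) (y := y))
  have l1 := radialSlope_le_div t₁ (dist_nonneg (x := x₁) (y := y))
  have l2 := radialSlope_le_div t₂ (dist_nonneg (x := x₂) (y := y))
  have k1 := (le_abs_self _).trans (abs_radialSlope_le ht₁ (dist x₁ y))
  have k2 := (le_abs_self _).trans (abs_radialSlope_le ht₂ (dist x₂ y))
  have p1 : 0 ≤ 1 / dist x₁ y := by positivity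
  have p2 : 0 ≤ 1 / dist x₂ y := by positivity
  have p3 : 0 ≤ 8 / c₀ := by positivity
  have far : ∀ x, c₀ / 2 ≤ dist x y → 2 * (1 / dist x y) ≤ 4 / c₀ := fun x hx ↦ by
    have : 1 / dist x y ≤ 1 / (c₀ / 2) := one_div_le_one_div_of_le (by positivity) hx
    have h : 1 / (c₀ / 2) = 2 / c₀ := by field_simp
    rw [h] at this
    calc 2 * (1 / dist x y) ≤ 2 * (2 / c₀) := by linarith
      _ = 4 / c₀ := by ring
  have h8 : 8 / c₀ = 2 * (4 / c₀) := by ring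
  have hq : 0 ≤ 4 / c₀ := by positivity
  -- If one slope is at most K and the other at most 2/d, the product is at most 2K/d.
  have hbound : ∀ K, 0 ≤ K → 2 * K ≤ 2 * C₀ + 8 / c₀ →
      (radialSlope t₁ (dist x₁ y) ≤ K ∨ radialSlope t₂ (dist x₂ y) ≤ K) →
      radialSlope t₁ (dist x₁ y) * radialSlope t₂ (dist x₂ y) ≤
      (2 * C₀ + 8 / c₀) * (1 / dist x₁ y + 1 / dist x₂ y) := by
    intro K hK hK' h
    have hm : 2 * K * (1 / dist x₁ y + 1 / dist x₂ y) ≤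
        (2 * C₀ + 8 / c₀) * (1 / dist x₁ y + 1 / dist x₂ y) := by gcongr
    refine le_trans ?_ hm
    rcases h with h | h
    · have := mul_le_mul h l2 n2 hK
      nlinarith
    · have := mul_le_mul l1 h n2 (by positivity)
      nlinarith
  rcases hsep with h | h | h
  · exact hbound C₀ hC₀ (by linarith) (Or.inl (k1.trans h))
  · exact hbound C₀ hC₀ (by linarith) (Or.inr (k2.trans h))
  -- Every y is at distance at least c₀/2 from one of the two separated points.
  · refine hbound (4 / c₀) hq (by linarith) ?_
    by_cases hy : c₀ / 2 ≤ dist x₁ y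
    · exact Or.inl (l1.trans (far x₁ hy))
    · refine Or.inr (l2.trans (far x₂ ?_))
      have := dist_triangle_right x₁ x₂ y
      push Not at hy
      linarith

variable [MeasurableSpace M] {μ : Measure M}

theorem measure_null_of_ball_le {C : ℝ}
    (hball : ∀ (x : M) r, 0 < r → μ (Metric.ball x r) ≤ ENNReal.ofReal (C * r ^ 2)) (x : M) :
    μ {x} = 0 := by
  have ht : Tendsto (fun r : ℝ ↦ ENNReal.ofReal (C * r ^ 2)) (𝓝[>] 0) (𝓝 0) := by
    have : Tendsto (fun r : ℝ ↦ ENNReal.ofReal (C * r ^ 2)) (𝓝 0)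
        (𝓝 (ENNReal.ofReal (C * 0 ^ 2))) :=
      (ENNReal.continuous_ofReal.comp (by fun_prop)).tendsto 0
    simp only [ne_eq, OfNat.ofNat_ne_zero, not_false_eq_true, zero_pow, mul_zero,
      ENNReal.ofReal_zero] at this
    exact this.mono_left nhdsWithin_le_nhds
  refine le_antisymm (ge_of_tendsto ht ?_) zero_le
  filter_upwards [self_mem_nhdsWithin] with r hr
  exact (measure_mono (singleton_subset_iff.2 (Metric.mem_ball_self hr))).trans (hball x r hr)

variable [BorelSpace M] [IsProbabilityMeasure μ]

/-- If balls have at most quadratic volume growth, then the inverse of the distance to a point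
is integrable. -/
theorem lintegral_inv_dist_le {C : ℝ} (hC : 0 ≤ C)
    (hball : ∀ (x : M) r, 0 < r → μ (Metric.ball x r) ≤ ENNReal.ofReal (C * r ^ 2)) (x : M) :
    ∫⁻ y, ENNReal.ofReal (1 / dist x y) ∂μ ≤ ENNReal.ofReal (1 + C) := by
  rw [lintegral_eq_lintegral_meas_lt μ (Eventually.of_forall fun y ↦ by positivity)
    (Measurable.aemeasurable (by fun_prop))]
  -- Layer cake: levels s ≤ 1 contribute at most the total mass, and for s > 1 the superlevel set
  -- lies in the ball of radius 1/s, of measure at most C/s².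
  rw [← Ioc_union_Ioi_eq_Ioi (zero_le_one (α := ℝ)),
    lintegral_union measurableSet_Ioi (Ioc_disjoint_Ioi le_rfl),
    ENNReal.ofReal_add zero_le_one hC]
  refine add_le_add ?_ ?_
  · calc _ ≤ ∫⁻ s in Ioc (0 : ℝ) 1, 1 := lintegral_mono fun s ↦ prob_le_one
      _ = ENNReal.ofReal 1 := by simp
  · have hi : ∫ s in Ioi (1 : ℝ), C * s ^ (-2 : ℝ) = C := by
      rw [integral_const_mul, integral_Ioi_rpow_of_lt (by norm_num) one_pos]
      norm_num
    calc _ ≤ ∫⁻ s in Ioi (1 : ℝ), ENNReal.ofReal (C * s ^ (-2 : ℝ)) := by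
          refine setLIntegral_mono' measurableSet_Ioi fun s hs ↦ ?_
          have hs0 : (0 : ℝ) < s := zero_lt_one.trans hs
          refine (measure_mono (t := Metric.ball x (1 / s)) fun y hy ↦ ?_).trans
            ((hball x (1 / s) (by positivity)).trans_eq ?_)
          · rw [mem_ofPred_eq] at hy
            have hd : 0 < dist x y := by
              by_contra! h
              have : dist x y = 0 := le_antisymm h dist_nonneg
              rw [this, div_zero] at hy
              linarith
            rw [Metric.mem_ball, dist_comm, lt_div_iff₀ hs0]
            rw [lt_div_iff₀ hd] at hy
            linarith
          · congr 1
            rw [Real.rpow_neg hs0.le, Real.rpow_two]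
            ring
      _ = ENNReal.ofReal C := by
          rw [← ofReal_integral_eq_lintegral_ofReal, hi]
          · exact ((integrableOn_Ioi_rpow_of_lt (by norm_num) one_pos).const_mul C)
          · refine (ae_restrict_iff' measurableSet_Ioi).2 (Eventually.of_forall fun s hs ↦ ?_)
            have hs0 : (0 : ℝ) < s := zero_lt_one.trans hs
            positivity

theorem integrable_inv_dist {C : ℝ} (hC : 0 ≤ C)
    (hball : ∀ (x : M) r, 0 < r → μ (Metric.ball x r) ≤ ENNReal.ofReal (C * r ^ 2)) (x : M) :
    Integrable (fun y ↦ 1 / dist x y) μ := by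
  refine ⟨Measurable.aestronglyMeasurable (by fun_prop), ?_⟩
  rw [hasFiniteIntegral_iff_ofReal (Eventually.of_forall fun y ↦ by positivity)]
  exact (lintegral_inv_dist_le hC hball x).trans_lt ENNReal.ofReal_lt_top

theorem integral_inv_dist_le {C : ℝ} (hC : 0 ≤ C)
    (hball : ∀ (x : M) r, 0 < r → μ (Metric.ball x r) ≤ ENNReal.ofReal (C * r ^ 2)) (x : M) :
    ∫ y, 1 / dist x y ∂μ ≤ 1 + C := by
  have h := lintegral_inv_dist_le hC hball x
  rwa [← ofReal_integral_eq_lintegral_ofReal (integrable_inv_dist hC hball x)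
    (Eventually.of_forall fun y ↦ by positivity),
    ENNReal.ofReal_le_ofReal_iff (by positivity)] at h

/-- The energy of `log (1 + t² d(x, ·)²)` grows at most like `8 κ log t`, if small balls have
volume at most `κ r²`. -/
theorem integral_radialSlope_sq_le {κ R : ℝ} (hκ : 0 ≤ κ) (hR : 0 < R)
    (hball : ∀ (x : M) r, 0 < r → r ≤ R → μ (Metric.ball x r) ≤ ENNReal.ofReal (κ * r ^ 2))
    {t : ℝ} (ht : 0 ≤ t) (x : M) :
    ∫ y, radialSlope t (dist x y) ^ 2 ∂μ ≤
      8 * κ * Real.log (max 1 t) + (4 / R ^ 2 + 4 * κ * |Real.log (4 / R ^ 2)|) := by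
  -- The level at which the ball of radius 2/√s reaches radius R.
  set s₀ := 4 / R ^ 2 with hs₀
  have hs₀pos : 0 < s₀ := by positivity
  have hT : 0 ≤ Real.log (max 1 t) := Real.log_nonneg (le_max_left _ _)
  have hf1 : ∀ y, radialSlope t (dist x y) ^ 2 ≤ t ^ 2 := fun y ↦ by
    have h := abs_radialSlope_le ht (dist x y)
    rw [← sq_abs (radialSlope t (dist x y))]
    gcongr
  by_cases hcase : t ^ 2 ≤ s₀
  · calc ∫ y, radialSlope t (dist x y) ^ 2 ∂μ ≤ ∫ y, s₀ ∂μ :=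
          integral_mono_of_nonneg (Eventually.of_forall fun y ↦ by positivity)
            (integrable_const _) (Eventually.of_forall fun y ↦ (hf1 y).trans hcase)
      _ = s₀ := by simp
      _ ≤ _ := by
        have : 0 ≤ 8 * κ * Real.log (max 1 t) := by positivity
        have : 0 ≤ 4 * κ * |Real.log s₀| := by positivity
        linarith
  push Not at hcase
  have hmeas : Measurable fun y ↦ radialSlope t (dist x y) ^ 2 := by
    unfold radialSlope
    fun_prop
  have hkey : ∫⁻ y, ENNReal.ofReal (radialSlope t (dist x y) ^ 2) ∂μ ≤
      ENNReal.ofReal (s₀ + 4 * κ * Real.log (t ^ 2 / s₀)) := by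
    -- Levels below s₀ cost at most the total mass; levels above t² are empty. In between, the
    -- superlevel set lies in the ball of radius 2/√s, of measure at most 4κ/s, and integration
    -- gives 4κ log(t²/s₀).
    rw [lintegral_eq_lintegral_meas_lt μ (Eventually.of_forall fun y ↦ by positivity)
      hmeas.aemeasurable]
    have hlog : 0 ≤ Real.log (t ^ 2 / s₀) :=
      Real.log_nonneg ((one_le_div hs₀pos).2 hcase.le)
    rw [← Ioc_union_Ioi_eq_Ioi hs₀pos.le, lintegral_union measurableSet_Ioi
      (Ioc_disjoint_Ioi le_rfl), ENNReal.ofReal_add hs₀pos.le (by positivity)]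
    refine add_le_add ?_ ?_
    · calc _ ≤ ∫⁻ s in Ioc (0 : ℝ) s₀, 1 := lintegral_mono fun s ↦ prob_le_one
        _ = ENNReal.ofReal s₀ := by simp
    · rw [← Ioc_union_Ioi_eq_Ioi hcase.le, lintegral_union measurableSet_Ioi
        (Ioc_disjoint_Ioi le_rfl)]
      have hz : ∫⁻ s in Ioi (t ^ 2), μ {y | s < radialSlope t (dist x y) ^ 2} = 0 := by
        refine (setLIntegral_congr_fun measurableSet_Ioi fun s hs ↦ ?_).trans lintegral_zero
        have : {y | s < radialSlope t (dist x y) ^ 2} = ∅ := by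
          ext y
          simp only [mem_ofPred_eq, mem_empty_iff_false, iff_false, not_lt]
          exact (hf1 y).trans (le_of_lt hs)
        simp [this]
      rw [hz, add_zero]
      have hii : ∫ s in s₀..t ^ 2, 4 * κ * s⁻¹ = 4 * κ * Real.log (t ^ 2 / s₀) := by
        rw [intervalIntegral.integral_const_mul, integral_inv_of_pos hs₀pos
          (hs₀pos.trans hcase)]
      have hint : IntervalIntegrable (fun s : ℝ ↦ 4 * κ * s⁻¹) volume s₀ (t ^ 2) := by
        refine ContinuousOn.intervalIntegrable ?_
        refine continuousOn_const.mul (continuousOn_inv₀.mono fun s hs ↦ ?_)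
        rw [uIcc_of_le hcase.le] at hs
        exact (hs₀pos.trans_le hs.1).ne'
      rw [intervalIntegrable_iff_integrableOn_Ioc_of_le hcase.le] at hint
      calc _ ≤ ∫⁻ s in Ioc s₀ (t ^ 2), ENNReal.ofReal (4 * κ * s⁻¹) := by
            refine setLIntegral_mono' measurableSet_Ioc fun s hs ↦ ?_
            have hs0 : 0 < s := hs₀pos.trans hs.1
            have hsq := Real.sq_sqrt hs0.le
            have hsq0 := Real.sqrt_pos.2 hs0
            refine (measure_mono (t := Metric.ball x (2 / √s)) fun y hy ↦ ?_).trans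
              ((hball x (2 / √s) (by positivity) ?_).trans_eq ?_)
            · rw [mem_ofPred_eq] at hy
              have hr := radialSlope_nonneg t (dist_nonneg (x := x) (y := y))
              have hy2 : √s < radialSlope t (dist x y) := by
                rw [Real.sqrt_lt' (by
                  rcases hr.eq_or_lt with h | h
                  · rw [← h] at hy; norm_num at hy; linarith
                  · exact h)]
                exact hy
              have hy3 := hy2.trans_le (radialSlope_le_div t dist_nonneg)
              have hd : 0 < dist x y := by
                by_contra! h
                have h0 : dist x y = 0 := le_antisymm h dist_nonneg
                rw [h0, div_zero, mul_zero] at hy3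
                linarith
              rw [Metric.mem_ball, dist_comm, lt_div_iff₀ hsq0]
              rw [mul_one_div, lt_div_iff₀ hd] at hy3
              linarith
            · rw [div_le_iff₀ hsq0]
              have h1 : s₀ ≤ s := hs.1.le
              rw [hs₀, div_le_iff₀ (by positivity)] at h1
              refine le_of_sq_le_sq ?_ (by positivity)
              rw [mul_pow, hsq]
              linarith
            · congr 1
              rw [div_pow, hsq]
              field_simp
              norm_num
        _ = ENNReal.ofReal (4 * κ * Real.log (t ^ 2 / s₀)) := by
            rw [← hii, intervalIntegral.integral_of_le hcase.le,
              ← ofReal_integral_eq_lintegral_ofReal hint]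
            refine (ae_restrict_iff' measurableSet_Ioc).2 (Eventually.of_forall fun s hs ↦ ?_)
            have hs0 : 0 < s := hs₀pos.trans hs.1
            positivity
  have hint : Integrable (fun y ↦ radialSlope t (dist x y) ^ 2) μ := by
    refine ⟨hmeas.aestronglyMeasurable, ?_⟩
    rw [hasFiniteIntegral_iff_ofReal (Eventually.of_forall fun y ↦ by positivity)]
    exact hkey.trans_lt ENNReal.ofReal_lt_top
  have hlog : 0 ≤ Real.log (t ^ 2 / s₀) := Real.log_nonneg ((one_le_div hs₀pos).2 hcase.le)
  rw [← ofReal_integral_eq_lintegral_ofReal hint (Eventually.of_forall fun y ↦ by positivity),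
    ENNReal.ofReal_le_ofReal_iff (by positivity)] at hkey
  refine hkey.trans ?_
  have ht0 : 0 < t := by
    rcases ht.eq_or_lt with h | h
    · rw [← h] at hcase; norm_num at hcase; linarith
    · exact h
  rw [Real.log_div (by positivity) hs₀pos.ne', Real.log_pow]
  have h1 : Real.log t ≤ Real.log (max 1 t) := Real.log_le_log ht0 (le_max_right _ _)
  have h2 := neg_abs_le (Real.log s₀)
  push_cast
  have h3 := mul_le_mul_of_nonneg_left h1 hκ
  have h4 := mul_le_mul_of_nonneg_left h2 hκ
  linarith

end Integrals

/-! ### Averages of the logarithmic bumps and the exponential integrals. -/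

section LogIntegrals

variable {M : Type*} [MetricSpace M]

theorem exp_logBump (t : ℝ) (x y : M) : Real.exp (logBump t x y) = 1 + t ^ 2 * dist x y ^ 2 :=
  Real.exp_log (one_add_pos t (dist x y))

theorem exp_logBump_combination (t₁ t₂ : ℝ) (x₁ x₂ y : M) :
    Real.exp (logBump t₂ x₂ y + -2 * logBump t₁ x₁ y) =
      (1 + t₂ ^ 2 * dist x₂ y ^ 2) / (1 + t₁ ^ 2 * dist x₁ y ^ 2) ^ 2 := by
  have h : -2 * logBump t₁ x₁ y = -(logBump t₁ x₁ y + logBump t₁ x₁ y) := by ring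
  rw [h, Real.exp_add, Real.exp_neg, Real.exp_add, exp_logBump, exp_logBump]
  ring

/-- With `max_sq_mul_le`, this makes 1 + t²r² comparable with max(1, t)² for r bounded above and
below. The maximum absorbs small t, including t = 0 at the vertex. -/
theorem one_add_le_max_sq {t : ℝ} (ht : 0 ≤ t) {r D : ℝ} (hr : 0 ≤ r) (hrD : r ≤ D) :
    1 + t ^ 2 * r ^ 2 ≤ max 1 t ^ 2 * (1 + D ^ 2) := by
  have h1 : 1 ≤ max 1 t ^ 2 := one_le_pow₀ (le_max_left _ _)
  have h2 : t ^ 2 ≤ max 1 t ^ 2 := by gcongr; exact le_max_right _ _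
  have h3 : r ^ 2 ≤ D ^ 2 := by gcongr
  have h4 : t ^ 2 * r ^ 2 ≤ max 1 t ^ 2 * D ^ 2 := by gcongr
  linarith

theorem max_sq_mul_le {t : ℝ} {r c : ℝ} (hc : 0 ≤ c) (hcr : c ≤ r) (hc1 : c ≤ 1) :
    max 1 t ^ 2 * c ^ 2 ≤ 1 + t ^ 2 * r ^ 2 := by
  have h1 : c ^ 2 ≤ 1 := pow_le_one₀ hc hc1
  have h2 : c ^ 2 ≤ r ^ 2 := by gcongr
  rcases max_choice 1 t with h | h <;> rw [h]
  · nlinarith [mul_nonneg (sq_nonneg t) (sq_nonneg r)]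
  · have := mul_le_mul_of_nonneg_left h2 (sq_nonneg t)
    linarith

theorem logBump_le {t : ℝ} (ht : 0 ≤ t) {x y : M} {D : ℝ} (hD : dist x y ≤ D) :
    logBump t x y ≤ 2 * Real.log (max 1 t) + Real.log (1 + D ^ 2) := by
  have h := Real.log_le_log (one_add_pos t (dist x y)) (one_add_le_max_sq ht dist_nonneg hD)
  have h1 : (0 : ℝ) < max 1 t := lt_max_of_lt_left one_pos
  rwa [Real.log_mul (by positivity) (by positivity), Real.log_pow] at h

/-- Uses log min(d, 1) ≥ -1/d: the loss near `x` is an integrable singularity with a bound uniform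
in `t` and `x`. -/
theorem le_logBump (t : ℝ) {x y : M} (hxy : 0 < dist x y) :
    2 * Real.log (max 1 t) - 2 * (1 / dist x y) ≤ logBump t x y := by
  have h1 : (0 : ℝ) < max 1 t := lt_max_of_lt_left one_pos
  have hm : 0 < min (dist x y) 1 := lt_min hxy one_pos
  have h := Real.log_le_log (by positivity) (max_sq_mul_le (t := t) hm.le (min_le_left _ _)
    (min_le_right _ _))
  rw [Real.log_mul (by positivity) (by positivity), Real.log_pow, Real.log_pow] at h
  have h2 : -(1 / dist x y) ≤ Real.log (min (dist x y) 1) := by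
    rcases min_choice (dist x y) 1 with h | h <;> rw [h]
    · have := Real.one_sub_inv_le_log_of_pos hxy
      rw [one_div]
      linarith
    · rw [Real.log_one]
      have : 0 < 1 / dist x y := by positivity
      linarith
  push_cast at h
  unfold logBump
  linarith

variable [CompactSpace M] [MeasurableSpace M] [BorelSpace M] {μ : Measure M}
  [IsProbabilityMeasure μ]

theorem integrable_of_continuous {f : M → ℝ} (hf : Continuous f) : Integrable f μ :=
  hf.integrable_of_hasCompactSupport (HasCompactSupport.of_compactSpace f)

theorem integral_logBump_le {t : ℝ} (ht : 0 ≤ t) (x : M) :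
    ∫ y, logBump t x y ∂μ ≤
      2 * Real.log (max 1 t) + Real.log (1 + Metric.diam (univ : Set M) ^ 2) := by
  have h := integral_mono (integrable_of_continuous (μ := μ) (continuous_logBump t x))
    (integrable_const (2 * Real.log (max 1 t) + Real.log (1 + Metric.diam (univ : Set M) ^ 2)))
    fun y ↦ logBump_le ht (Metric.dist_le_diam_of_mem isCompact_univ.isBounded (mem_univ x)
      (mem_univ y))
  simpa using h

theorem le_integral_logBump {C : ℝ} (hC : 0 ≤ C)
    (hball : ∀ (x : M) r, 0 < r → μ (Metric.ball x r) ≤ ENNReal.ofReal (C * r ^ 2))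
    (t : ℝ) (x : M) :
    2 * Real.log (max 1 t) - 2 * (1 + C) ≤ ∫ y, logBump t x y ∂μ := by
  have hi := integrable_inv_dist hC hball x
  have h := integral_mono_ae ((integrable_const (2 * Real.log (max 1 t))).sub (hi.const_mul 2))
    (integrable_of_continuous (μ := μ) (continuous_logBump t x)) (by
      have h0 := measure_null_of_ball_le hball x
      filter_upwards [compl_mem_ae_iff.2 h0] with y hy
      exact le_logBump t (dist_pos.2 fun h ↦ hy h.symm))
  simp only [Pi.sub_apply] at h
  rw [integral_sub (integrable_const _) (hi.const_mul 2), integral_const, integral_const_mul] at h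
  have h2 := integral_inv_dist_le hC hball x
  simp only [probReal_univ, one_smul] at h
  linarith

theorem mul_measureReal_le_integral {f : M → ℝ} (hf : Continuous f) (hf0 : ∀ y, 0 ≤ f y)
    {S : Set M} {c : ℝ} (hS : ∀ y ∈ S, c ≤ f y) (hc : 0 ≤ c) :
    c * μ.real S ≤ ∫ y, f y ∂μ := by
  refine le_trans ?_ (mul_meas_ge_le_integral_of_nonneg (Eventually.of_forall hf0)
    (integrable_of_continuous (μ := μ) hf) c)
  exact mul_le_mul_of_nonneg_left (measureReal_mono hS) hc

/-- The concentration of `exp φ` at the points where the bubbles sit. -/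
theorem exists_neg_log_integral_le {C R : ℝ} (hC : 0 ≤ C) (hR : 0 < R)
    (hup : ∀ (x : M) r, 0 < r → μ (Metric.ball x r) ≤ ENNReal.ofReal (C * r ^ 2))
    (hlow : ∀ (x : M) r, 0 < r → r ≤ R → ENNReal.ofReal (r ^ 2 / 10) ≤ μ (Metric.ball x r))
    {h : M → ℝ} (hh : Continuous h) {m : ℝ} (hm : 0 < m) (hmh : ∀ y, m ≤ h y)
    (C₀ : ℝ) {c₀ : ℝ} (hc₀ : 0 < c₀) :
    ∃ C', ∀ t₁ t₂ : ℝ, 0 ≤ t₁ → 0 ≤ t₂ → ∀ x₁ x₂ : M,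
      (t₁ ≤ C₀ ∨ t₂ ≤ C₀ ∨ c₀ ≤ dist x₁ x₂) →
      -Real.log (∫ y, h y * Real.exp (logBump t₂ x₂ y + -2 * logBump t₁ x₁ y) ∂μ) ≤
        2 * Real.log (max 1 t₁) - 2 * Real.log (max 1 t₂) + C' := by
  set D := Metric.diam (univ : Set M)
  have hdist : ∀ x y : M, dist x y ≤ D := fun x y ↦
    Metric.dist_le_diam_of_mem isCompact_univ.isBounded (mem_univ x) (mem_univ y)
  suffices hq : ∃ q > 0, ∀ t₁ t₂ : ℝ, 0 ≤ t₁ → 0 ≤ t₂ → ∀ x₁ x₂ : M,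
      (t₁ ≤ C₀ ∨ t₂ ≤ C₀ ∨ c₀ ≤ dist x₁ x₂) →
      q * (max 1 t₂ ^ 2 / max 1 t₁ ^ 2) ≤
        ∫ y, h y * Real.exp (logBump t₂ x₂ y + -2 * logBump t₁ x₁ y) ∂μ by
    obtain ⟨q, hq, hle⟩ := hq
    refine ⟨-Real.log q, fun t₁ t₂ ht₁ ht₂ x₁ x₂ hsep ↦ ?_⟩
    have h1 : (0 : ℝ) < max 1 t₁ := lt_max_of_lt_left one_pos
    have h2 : (0 : ℝ) < max 1 t₂ := lt_max_of_lt_left one_pos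
    have h3 := Real.log_le_log (by positivity) (hle t₁ t₂ ht₁ ht₂ x₁ x₂ hsep)
    rw [Real.log_mul (by positivity) (by positivity), Real.log_div (by positivity)
      (by positivity), Real.log_pow, Real.log_pow] at h3
    push_cast at h3
    linarith
  have hcont : ∀ (t₁ t₂ : ℝ) (x₁ x₂ : M), Continuous fun y ↦
      h y * Real.exp (logBump t₂ x₂ y + -2 * logBump t₁ x₁ y) := fun t₁ t₂ x₁ x₂ ↦
    hh.mul (((continuous_logBump t₂ x₂).add
      (continuous_const.mul (continuous_logBump t₁ x₁))).rexp)
  have hnn : ∀ (t₁ t₂ : ℝ) (x₁ x₂ : M) y,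
      0 ≤ h y * Real.exp (logBump t₂ x₂ y + -2 * logBump t₁ x₁ y) := fun t₁ t₂ x₁ x₂ y ↦
    mul_nonneg (hm.le.trans (hmh y)) (Real.exp_pos _).le
  -- the case of a bounded first parameter
  obtain ⟨qA, hqA, hA⟩ : ∃ q > 0, ∀ t₁ t₂ : ℝ, 0 ≤ t₁ → 0 ≤ t₂ → ∀ x₁ x₂ : M, t₁ ≤ C₀ →
      q * (max 1 t₂ ^ 2 / max 1 t₁ ^ 2) ≤
        ∫ y, h y * Real.exp (logBump t₂ x₂ y + -2 * logBump t₁ x₁ y) ∂μ := by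
    -- Then Cr² ≤ 1/2, so half of the mass lies outside the ball about x₂. There the numerator is at
    -- least max(1, t₂)²r², while bounded t₁ bounds the denominator.
    set r := √(1 / (2 * C + 1)) with hr
    have hr0 : 0 < r := Real.sqrt_pos.2 (by positivity)
    have hr2 : r ^ 2 = 1 / (2 * C + 1) := Real.sq_sqrt (by positivity)
    have hr1 : r ≤ 1 := by
      refine Real.sqrt_le_iff.2 ⟨zero_le_one, ?_⟩
      rw [one_pow, div_le_one (by positivity)]
      linarith
    refine ⟨m * (r ^ 2 / (1 + C₀ ^ 2 * D ^ 2) ^ 2) * (1 / 2), by positivity,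
      fun t₁ t₂ ht₁ ht₂ x₁ x₂ hle ↦ ?_⟩
    have hvol : 1 / 2 ≤ μ.real (Metric.ball x₂ r)ᶜ := by
      rw [probReal_compl_eq_one_sub Metric.isOpen_ball.measurableSet]
      have h1 : μ.real (Metric.ball x₂ r) ≤ C * r ^ 2 :=
        ENNReal.toReal_le_of_le_ofReal (by positivity) (hup x₂ r hr0)
      have h2 : C * r ^ 2 ≤ 1 / 2 := by
        rw [hr2, mul_one_div, div_le_div_iff₀ (by positivity) (by norm_num)]
        linarith
      linarith
    have h1 := mul_measureReal_le_integral (μ := μ) (hcont t₁ t₂ x₁ x₂) (hnn t₁ t₂ x₁ x₂)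
      (S := (Metric.ball x₂ r)ᶜ)
      (c := m * (max 1 t₂ ^ 2 * r ^ 2 / (1 + C₀ ^ 2 * D ^ 2) ^ 2)) (fun y hy ↦ by
        rw [exp_logBump_combination]
        have hy' : r ≤ dist x₂ y := by
          rw [mem_compl_iff, Metric.mem_ball, not_lt, dist_comm] at hy
          exact hy
        have k1 := max_sq_mul_le (t := t₂) hr0.le hy' hr1
        have k2 : 1 + t₁ ^ 2 * dist x₁ y ^ 2 ≤ 1 + C₀ ^ 2 * D ^ 2 := by
          have := hdist x₁ y
          gcongr
        have k3 := one_add_pos t₁ (dist x₁ y)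
        have k4 := hmh y
        have k5 := hm.le.trans k4
        gcongr) (by positivity)
    refine le_trans ?_ h1
    have h3 : max 1 t₂ ^ 2 / max 1 t₁ ^ 2 ≤ max 1 t₂ ^ 2 :=
      div_le_self (by positivity) (one_le_pow₀ (le_max_left _ _))
    calc m * (r ^ 2 / (1 + C₀ ^ 2 * D ^ 2) ^ 2) * (1 / 2) * (max 1 t₂ ^ 2 / max 1 t₁ ^ 2)
        ≤ m * (r ^ 2 / (1 + C₀ ^ 2 * D ^ 2) ^ 2) * (1 / 2) * max 1 t₂ ^ 2 := by gcongr
      _ = m * (max 1 t₂ ^ 2 * r ^ 2 / (1 + C₀ ^ 2 * D ^ 2) ^ 2) * (1 / 2) := by ring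
      _ ≤ _ := by gcongr
  -- the case of a bounded second parameter, or of separated points
  obtain ⟨qB, hqB, hB⟩ : ∃ q > 0, ∀ t₁ t₂ : ℝ, 0 ≤ t₁ → 0 ≤ t₂ → ∀ x₁ x₂ : M,
      (t₂ ≤ C₀ ∨ c₀ ≤ dist x₁ x₂) → q * (max 1 t₂ ^ 2 / max 1 t₁ ^ 2) ≤
        ∫ y, h y * Real.exp (logBump t₂ x₂ y + -2 * logBump t₁ x₁ y) ∂μ := by
    -- The three bounds serve, in order, the lower volume bound, t₁d(x₁,y) ≤ 1 on the ball used
    -- below, and distance at least c₀/2 of that ball from x₂ when the points are separated.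
    set R' := min (min R 1) (c₀ / 2) with hR'
    have hR'0 : 0 < R' := lt_min (lt_min hR one_pos) (by positivity)
    have hR'R : R' ≤ R := (min_le_left _ _).trans (min_le_left _ _)
    have hR'1 : R' ≤ 1 := (min_le_left _ _).trans (min_le_right _ _)
    have hR'c : R' ≤ c₀ / 2 := min_le_right _ _
    -- A lower bound for the numerator relative to max(1, t₂)²: the first entry serves bounded t₂,
    -- the second separated points.
    set q' := min (1 / max 1 C₀ ^ 2) (R' ^ 2) with hq'
    have hmax : (0 : ℝ) < max 1 C₀ := lt_max_of_lt_left one_pos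
    have hq'0 : 0 < q' := lt_min (by positivity) (by positivity)
    -- On the ball of radius R'/max(1, t₁) about x₁ the denominator is at most 2² = 4; its mass, at
    -- least R'²/(10 max(1, t₁)²), gives the remaining factor.
    refine ⟨m * (q' / 4) * (R' ^ 2 / 10), by positivity, fun t₁ t₂ ht₁ ht₂ x₁ x₂ hsep ↦ ?_⟩
    have hτ : (1 : ℝ) ≤ max 1 t₁ := le_max_left _ _
    have hτ0 : (0 : ℝ) < max 1 t₁ := one_pos.trans_le hτ
    have hr0 : 0 < R' / max 1 t₁ := by positivity
    have hrR' : R' / max 1 t₁ ≤ R' := div_le_self hR'0.le hτ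
    have hvol : (R' / max 1 t₁) ^ 2 / 10 ≤ μ.real (Metric.ball x₁ (R' / max 1 t₁)) :=
      (ENNReal.ofReal_le_iff_le_toReal (measure_ne_top _ _)).1
        (hlow x₁ _ hr0 (hrR'.trans hR'R))
    have h1 := mul_measureReal_le_integral (μ := μ) (hcont t₁ t₂ x₁ x₂) (hnn t₁ t₂ x₁ x₂)
      (S := Metric.ball x₁ (R' / max 1 t₁)) (c := m * (q' * max 1 t₂ ^ 2 / 2 ^ 2)) (fun y hy ↦ by
        rw [exp_logBump_combination]
        rw [Metric.mem_ball, dist_comm] at hy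
        have k1 : 1 + t₁ ^ 2 * dist x₁ y ^ 2 ≤ 2 := by
          have h2 : t₁ * dist x₁ y ≤ 1 := by
            calc t₁ * dist x₁ y ≤ max 1 t₁ * (R' / max 1 t₁) :=
                  mul_le_mul (le_max_right _ _) hy.le dist_nonneg hτ0.le
              _ = R' := by field_simp
              _ ≤ 1 := hR'1
          have h3 : (t₁ * dist x₁ y) ^ 2 ≤ 1 := pow_le_one₀ (by positivity) h2
          rw [mul_pow] at h3
          linarith
        have k2 : q' * max 1 t₂ ^ 2 ≤ 1 + t₂ ^ 2 * dist x₂ y ^ 2 := by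
          rcases hsep with hs | hs
          · have h2 : max 1 t₂ ^ 2 ≤ max 1 C₀ ^ 2 := by gcongr
            calc q' * max 1 t₂ ^ 2 ≤ 1 / max 1 C₀ ^ 2 * max 1 C₀ ^ 2 := by
                  gcongr
                  exact min_le_left _ _
              _ = 1 := by field_simp
              _ ≤ _ := by
                have : 0 ≤ t₂ ^ 2 * dist x₂ y ^ 2 := by positivity
                linarith
          · have h2 : R' ≤ dist x₂ y := by
              have := dist_triangle_right x₁ x₂ y
              linarith
            have h3 := max_sq_mul_le (t := t₂) hR'0.le h2 hR'1
            refine le_trans ?_ h3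
            rw [mul_comm]
            gcongr
            exact min_le_right _ _
        have k3 := one_add_pos t₁ (dist x₁ y)
        have k4 := hmh y
        have k5 := hm.le.trans k4
        gcongr) (by positivity)
    refine le_trans ?_ h1
    calc m * (q' / 4) * (R' ^ 2 / 10) * (max 1 t₂ ^ 2 / max 1 t₁ ^ 2)
        = m * (q' * max 1 t₂ ^ 2 / 2 ^ 2) * ((R' / max 1 t₁) ^ 2 / 10) := by ring
      _ ≤ _ := by gcongr
  refine ⟨min qA qB, lt_min hqA hqB, fun t₁ t₂ ht₁ ht₂ x₁ x₂ hsep ↦ ?_⟩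
  rcases hsep with hs | hs
  · refine le_trans ?_ (hA t₁ t₂ ht₁ ht₂ x₁ x₂ hs)
    gcongr
    exact min_le_left _ _
  · refine le_trans ?_ (hB t₁ t₂ ht₁ ht₂ x₁ x₂ hs)
    gcongr
    exact min_le_right _ _

end LogIntegrals

/-! ### The energy of the test functions -/

section Energy

variable {M : Type*} [MetricSpace M]

theorem exists_lipschitzWith_combination {t₁ t₂ : ℝ} (ht₁ : 0 ≤ t₁) (ht₂ : 0 ≤ t₂) (x₁ x₂ : M) :
    ∃ K, LipschitzWith K fun y ↦ logBump t₂ x₂ y + -2 * logBump t₁ x₁ y :=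
  ⟨_, (lipschitzWith_logBump ht₂ x₂).add
    ((lipschitzWith_smul (-2 : ℝ)).comp (lipschitzWith_logBump ht₁ x₁))⟩

variable [ChartedSpace Plane M]
  [IsManifold (𝓡 2) ∞ M] [RiemannianBundle (fun x : M ↦ TangentSpace (𝓡 2) x)]
  [IsContMDiffRiemannianBundle (𝓡 2) ∞ Plane (fun x : M ↦ TangentSpace (𝓡 2) x)]
  [IsRiemannianManifold (𝓡 2) M]

theorem norm_ptGrad_logBump_le (t : ℝ) (x y : M) :
    ‖ptGrad (logBump t x) y‖ ≤ radialSlope t (dist x y) :=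
  norm_ptGrad_le (radialSlope_nonneg t dist_nonneg) fun _ hL ↦
    eventually_abs_logBump_sub_le t x y hL

variable [CompactSpace M] [MeasurableSpace M] [BorelSpace M]
  [IsProbabilityMeasure (riemVolume M)]

theorem memH1_combination {t₁ t₂ : ℝ} (ht₁ : 0 ≤ t₁) (ht₂ : 0 ≤ t₂) (x₁ x₂ : M) :
    MemH1 fun y ↦ logBump t₂ x₂ y + -2 * logBump t₁ x₁ y := by
  obtain ⟨K, hK⟩ := exists_lipschitzWith_combination ht₁ ht₂ x₁ x₂
  exact memH1_of_lipschitz hK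

theorem ae_grad_combination {t₁ t₂ : ℝ} (ht₁ : 0 ≤ t₁) (ht₂ : 0 ≤ t₂) (x₁ x₂ : M) :
    ∀ᵐ y ∂(riemVolume M), grad (fun y ↦ logBump t₂ x₂ y + -2 * logBump t₁ x₁ y) y =
      ptGrad (logBump t₂ x₂) y + (-2 : ℝ) • ptGrad (logBump t₁ x₁) y := by
  obtain ⟨K, hK⟩ := exists_lipschitzWith_combination ht₁ ht₂ x₁ x₂
  filter_upwards [ae_grad_eq hK, ae_mdifferentiableAt (lipschitzWith_logBump ht₁ x₁),
    ae_mdifferentiableAt (lipschitzWith_logBump ht₂ x₂)] with y h1 h2 h3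
  rw [h1, ptGrad_add_smul (-2) h3 h2]

/-- In terms of the gradients `a`, `b` of the logarithms of the two bumps, the energy density
is `|a|² + |b|² - a · b`. -/
theorem quadratic_identity {V : Type*} [NormedAddCommGroup V] [InnerProductSpace ℝ V] (a b : V) :
    1 / 3 * (‖b + (-2 : ℝ) • a‖ ^ 2 + ‖a + (-2 : ℝ) • b‖ ^ 2 +
      inner ℝ (b + (-2 : ℝ) • a) (a + (-2 : ℝ) • b)) =
      ‖a‖ ^ 2 + ‖b‖ ^ 2 - inner ℝ a b := by
  simp only [← real_inner_self_eq_norm_sq, inner_add_left, inner_add_right, real_inner_smul_left,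
    real_inner_smul_right, real_inner_comm a b]
  ring

/-- Nonnegativity is included so that the integral of `Q` can be bounded without proving `Q`
integrable. -/
theorem ae_Q_le {t₁ t₂ : ℝ} (ht₁ : 0 ≤ t₁) (ht₂ : 0 ≤ t₂) (x₁ x₂ : M) :
    ∀ᵐ y ∂(riemVolume M),
      0 ≤ Q (fun y ↦ logBump t₂ x₂ y + -2 * logBump t₁ x₁ y)
        (fun y ↦ logBump t₁ x₁ y + -2 * logBump t₂ x₂ y) y ∧
      Q (fun y ↦ logBump t₂ x₂ y + -2 * logBump t₁ x₁ y)
        (fun y ↦ logBump t₁ x₁ y + -2 * logBump t₂ x₂ y) y ≤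
        radialSlope t₁ (dist x₁ y) ^ 2 + radialSlope t₂ (dist x₂ y) ^ 2 +
          radialSlope t₁ (dist x₁ y) * radialSlope t₂ (dist x₂ y) := by
  filter_upwards [ae_grad_combination ht₁ ht₂ x₁ x₂, ae_grad_combination ht₂ ht₁ x₂ x₁]
    with y h1 h2
  rw [Q, h1, h2, quadratic_identity]
  set a := ptGrad (logBump t₁ x₁) y
  set b := ptGrad (logBump t₂ x₂) y
  have ha : ‖a‖ ≤ radialSlope t₁ (dist x₁ y) := norm_ptGrad_logBump_le t₁ x₁ y
  have hb : ‖b‖ ≤ radialSlope t₂ (dist x₂ y) := norm_ptGrad_logBump_le t₂ x₂ y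
  have hab := abs_le.1 (abs_real_inner_le_norm a b)
  have na := norm_nonneg a
  have nb := norm_nonneg b
  have hm := mul_le_mul ha hb nb (na.trans ha)
  have h3 : ‖a‖ ^ 2 ≤ radialSlope t₁ (dist x₁ y) ^ 2 := by gcongr
  have h4 : ‖b‖ ^ 2 ≤ radialSlope t₂ (dist x₂ y) ^ 2 := by gcongr
  constructor
  · nlinarith [sq_nonneg (‖a‖ - ‖b‖)]
  · linarith [hab.1]

/-- The strict inequality ρ > 4π leaves room for the metric distortion ε. -/
theorem exists_density_lt {ρ : ℝ} (hρ : 4 * Real.pi < ρ) :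
    ∃ ε : ℝ, 0 < ε ∧ ε < 1 ∧ 4 * ((1 + ε) / (1 - ε) ^ 2 * Real.pi) < ρ := by
  have ht : Tendsto (fun ε : ℝ ↦ 4 * ((1 + ε) / (1 - ε) ^ 2 * Real.pi)) (𝓝[>] 0)
      (𝓝 (4 * ((1 + 0) / (1 - 0) ^ 2 * Real.pi))) := by
    refine Tendsto.mono_left ?_ nhdsWithin_le_nhds
    refine ContinuousAt.tendsto ?_
    refine continuousAt_const.mul (ContinuousAt.mul (ContinuousAt.div (by fun_prop)
      (by fun_prop) (by norm_num)) continuousAt_const)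
  have h1 := ht.eventually_lt_const (u := ρ) (by norm_num; linarith)
  obtain ⟨ε, h, h'⟩ := (h1.and (Ioo_mem_nhdsGT (zero_lt_one (α := ℝ)))).exists
  exact ⟨ε, h'.1, h'.2, h⟩

/-- The functional on the test functions decays linearly in the logarithms of the parameters,
as long as the two bubbles do not collide. -/
theorem exists_J_le {h₁ h₂ : M → ℝ} (hh₁ : Continuous h₁) (hh₂ : Continuous h₂)
    (hpos₁ : ∀ x, 0 < h₁ x) (hpos₂ : ∀ x, 0 < h₂ x) {ρ₁ ρ₂ : ℝ} (hρ₁ : 4 * Real.pi < ρ₁)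
    (hρ₂ : 4 * Real.pi < ρ₂) {C₀ c₀ : ℝ} (hC₀ : 0 ≤ C₀) (hc₀ : 0 < c₀) :
    ∃ a > 0, ∃ C, ∀ t₁ t₂ : ℝ, 0 ≤ t₁ → 0 ≤ t₂ → ∀ x₁ x₂ : M,
      (t₁ ≤ C₀ ∨ t₂ ≤ C₀ ∨ c₀ ≤ dist x₁ x₂) →
      J ρ₁ ρ₂ h₁ h₂ (fun y ↦ logBump t₂ x₂ y + -2 * logBump t₁ x₁ y)
        (fun y ↦ logBump t₁ x₁ y + -2 * logBump t₂ x₂ y) ≤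
        C - a * (Real.log (max 1 t₁) + Real.log (max 1 t₂)) := by
  have hne : Nonempty M := nonempty_of_isProbabilityMeasure (riemVolume M)
  obtain ⟨ε, hε, hε1, hερ⟩ := exists_density_lt (lt_min hρ₁ hρ₂)
  obtain ⟨R, hR, hball⟩ := exists_ball_volume_le (M := M) hε hε1
  obtain ⟨R₁, hR₁, hlow⟩ := exists_le_ball_volume (M := M)
  set κ := (1 + ε) / (1 - ε) ^ 2 * Real.pi with hκ
  have hκ0 : 0 ≤ κ := by positivity
  have hballκ : ∀ (x : M) r, 0 < r → r ≤ R →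
      riemVolume M (Metric.ball x r) ≤ ENNReal.ofReal (κ * r ^ 2) := fun x r hr hrR ↦ by
    rw [hκ, mul_assoc]
    exact hball x r hr hrR
  -- A quadratic volume bound at all radii: for r ≥ R, the total mass 1 is at most r²/R².
  set B := κ + 1 / R ^ 2 with hB
  have hB0 : 0 ≤ B := by positivity
  have hup : ∀ (x : M) r, 0 < r →
      riemVolume M (Metric.ball x r) ≤ ENNReal.ofReal (B * r ^ 2) := fun x r hr ↦ by
    rcases le_total r R with h | h
    · refine (hballκ x r hr h).trans (ENNReal.ofReal_le_ofReal ?_)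
      gcongr
      rw [hB]
      linarith [show 0 ≤ 1 / R ^ 2 by positivity]
    · refine prob_le_one.trans ?_
      rw [← ENNReal.ofReal_one]
      refine ENNReal.ofReal_le_ofReal ?_
      have h1 : 1 ≤ 1 / R ^ 2 * r ^ 2 := by
        rw [one_div, inv_mul_eq_div, one_le_div (by positivity)]
        gcongr
      have h2 : 0 ≤ κ * r ^ 2 := by positivity
      rw [hB, add_mul]
      linarith
  obtain ⟨p₁, -, hp₁⟩ := isCompact_univ.exists_isMinOn univ_nonempty hh₁.continuousOn
  obtain ⟨p₂, -, hp₂⟩ := isCompact_univ.exists_isMinOn univ_nonempty hh₂.continuousOn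
  obtain ⟨C₁, hC₁⟩ := exists_neg_log_integral_le hB0 hR₁ hup hlow hh₁ (hpos₁ p₁)
    (fun y ↦ hp₁ (mem_univ y)) C₀ hc₀
  obtain ⟨C₂, hC₂⟩ := exists_neg_log_integral_le hB0 hR₁ hup hlow hh₂ (hpos₂ p₂)
    (fun y ↦ hp₂ (mem_univ y)) C₀ hc₀
  have hm1 := min_le_left ρ₁ ρ₂
  have hm2 := min_le_right ρ₁ ρ₂
  set ρ := min ρ₁ ρ₂
  set D' := Real.log (1 + Metric.diam (univ : Set M) ^ 2)
  set E := 4 / R ^ 2 + 4 * κ * |Real.log (4 / R ^ 2)|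
  -- The energy grows at rate 8κ in each Tᵢ, and the other terms fall at rate 2ρᵢ; the rate is
  -- positive because 4κ < ρ.
  refine ⟨2 * ρ - 8 * κ, by linarith, 2 * E + (2 * C₀ + 8 / c₀) * (2 * (1 + B)) +
    ρ₁ * (D' + 4 * (1 + B) + C₁) + ρ₂ * (D' + 4 * (1 + B) + C₂),
    fun t₁ t₂ ht₁ ht₂ x₁ x₂ hsep ↦ ?_⟩
  set T₁ := Real.log (max 1 t₁)
  set T₂ := Real.log (max 1 t₂)
  have hT₁ : 0 ≤ T₁ := Real.log_nonneg (le_max_left _ _)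
  have hT₂ : 0 ≤ T₂ := Real.log_nonneg (le_max_left _ _)
  have hi1 := integrable_inv_dist hB0 hup x₁
  have hi2 := integrable_inv_dist hB0 hup x₂
  have hs : ∀ (t : ℝ) (x : M), Integrable (fun y ↦ radialSlope t (dist x y) ^ 2)
      (riemVolume M) := fun t x ↦ by
    refine integrable_of_continuous (Continuous.pow (Continuous.div (by fun_prop) (by fun_prop)
      fun y ↦ (one_add_pos t (dist x y)).ne') 2)
  have hQ : ∫ y, Q (fun y ↦ logBump t₂ x₂ y + -2 * logBump t₁ x₁ y)
      (fun y ↦ logBump t₁ x₁ y + -2 * logBump t₂ x₂ y) y ∂(riemVolume M) ≤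
      8 * κ * T₁ + E + (8 * κ * T₂ + E) + (2 * C₀ + 8 / c₀) * (2 * (1 + B)) := by
    have hss : Integrable (fun y ↦ radialSlope t₁ (dist x₁ y) ^ 2 +
        radialSlope t₂ (dist x₂ y) ^ 2) (riemVolume M) := (hs t₁ x₁).add (hs t₂ x₂)
    have hii : Integrable (fun y ↦ (2 * C₀ + 8 / c₀) * (1 / dist x₁ y + 1 / dist x₂ y))
        (riemVolume M) := (hi1.add hi2).const_mul _
    have hg : Integrable (fun y ↦ radialSlope t₁ (dist x₁ y) ^ 2 +
        radialSlope t₂ (dist x₂ y) ^ 2 + (2 * C₀ + 8 / c₀) * (1 / dist x₁ y + 1 / dist x₂ y))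
        (riemVolume M) := hss.add hii
    have hQ1 := ae_Q_le ht₁ ht₂ x₁ x₂
    refine (integral_mono_of_nonneg (hQ1.mono fun y hy ↦ hy.1) hg ?_).trans ?_
    · filter_upwards [hQ1] with y hy
      exact hy.2.trans (add_le_add le_rfl (radialSlope_mul_le hC₀ hc₀ ht₁ ht₂ hsep y))
    · rw [integral_add hss hii,
        integral_add (hs t₁ x₁) (hs t₂ x₂), integral_const_mul, integral_add hi1 hi2]
      have k1 := integral_radialSlope_sq_le hκ0 hR hballκ ht₁ x₁
      have k2 := integral_radialSlope_sq_le hκ0 hR hballκ ht₂ x₂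
      have k3 := integral_inv_dist_le hB0 hup x₁
      have k4 := integral_inv_dist_le hB0 hup x₂
      have k5 : (2 * C₀ + 8 / c₀) * (∫ y, 1 / dist x₁ y ∂(riemVolume M) +
          ∫ y, 1 / dist x₂ y ∂(riemVolume M)) ≤ (2 * C₀ + 8 / c₀) * (2 * (1 + B)) := by
        gcongr
        linarith
      linarith
  have hφ : ∀ (t t' : ℝ) (x x' : M), 0 ≤ t' →
      ∫ y, (logBump t' x' y + -2 * logBump t x y) ∂(riemVolume M) ≤
        2 * Real.log (max 1 t') + D' - 2 * (2 * Real.log (max 1 t) - 2 * (1 + B)) := by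
    intro t t' x x' ht'
    rw [integral_add (integrable_of_continuous (continuous_logBump t' x'))
      ((integrable_of_continuous (continuous_logBump t x)).const_mul _), integral_const_mul]
    have k1 := integral_logBump_le (μ := riemVolume M) ht' x'
    have k2 := le_integral_logBump hB0 hup t x
    linarith
  have hl1 := hC₁ t₁ t₂ ht₁ ht₂ x₁ x₂ hsep
  have hl2 := hC₂ t₂ t₁ ht₂ ht₁ x₂ x₁ (by
    rw [dist_comm x₂ x₁]
    tauto)
  have hf1 := hφ t₁ t₂ x₁ x₂ ht₂
  have hf2 := hφ t₂ t₁ x₂ x₁ ht₁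
  have hρ₁0 : 0 ≤ ρ₁ := by linarith [Real.pi_pos]
  have hρ₂0 : 0 ≤ ρ₂ := by linarith [Real.pi_pos]
  unfold J
  -- The mean contributes 2T₂ - 4T₁ and the logarithm 2T₁ - 2T₂, so T₂ cancels.
  have hb1 : (∫ y, (logBump t₂ x₂ y + -2 * logBump t₁ x₁ y) ∂(riemVolume M)) -
      Real.log (∫ y, h₁ y * Real.exp (logBump t₂ x₂ y + -2 * logBump t₁ x₁ y)
        ∂(riemVolume M)) ≤ D' + 4 * (1 + B) + C₁ - 2 * T₁ := by linarith
  have hb2 : (∫ y, (logBump t₁ x₁ y + -2 * logBump t₂ x₂ y) ∂(riemVolume M)) -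
      Real.log (∫ y, h₂ y * Real.exp (logBump t₁ x₁ y + -2 * logBump t₂ x₂ y)
        ∂(riemVolume M)) ≤ D' + 4 * (1 + B) + C₂ - 2 * T₂ := by linarith
  have hc1 := mul_le_mul_of_nonneg_left hb1 hρ₁0
  have hc2 := mul_le_mul_of_nonneg_left hb2 hρ₂0
  have hd1 := mul_le_mul_of_nonneg_right hm1 hT₁
  have hd2 := mul_le_mul_of_nonneg_right hm2 hT₂
  refine (add_le_add hQ (add_le_add hc1 hc2)).trans ?_
  linarith

end Energy

/-! ### The parameters -/

section Parameters

variable {M : Type*} [MetricSpace M] {δ : ℝ}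

theorem tilde_nonneg (hδ : 0 < δ) {t : ℝ} (ht : 0 < t) (htδ : t ≤ δ) : 0 ≤ tilde δ t := by
  unfold tilde
  split_ifs
  · positivity
  · have : 0 ≤ 4 / δ ^ 2 * (δ - t) := mul_nonneg (by positivity) (by linarith)
    linarith

/-- The two summands bound the branches 1/t and -(4/δ²)(t - δ) respectively. -/
theorem tilde_le (hδ : 0 < δ) {t : ℝ} (ht : δ ^ 2 / 2 ≤ t) :
    tilde δ t ≤ 2 / δ ^ 2 + 2 / δ := by
  have h1 : 0 < 2 / δ ^ 2 := by positivity
  have h2 : 0 < 2 / δ := by positivity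
  unfold tilde
  split_ifs with h
  · have h3 : 1 / t ≤ 1 / (δ ^ 2 / 2) := one_div_le_one_div_of_le (by positivity) ht
    have h4 : 1 / (δ ^ 2 / 2) = 2 / δ ^ 2 := by field_simp
    linarith
  · push Not at h
    have h3 : 4 / δ ^ 2 * (δ - t) ≤ 4 / δ ^ 2 * (δ / 2) := by
      gcongr
      linarith
    have h4 : 4 / δ ^ 2 * (δ / 2) = 2 / δ := by field_simp; norm_num
    linarith

theorem le_log_tilde {t ν : ℝ} (ht : 0 < t) (htν : t ≤ ν) (hν : ν ≤ δ / 2) :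
    Real.log (1 / ν) ≤ Real.log (max 1 (tilde δ t)) := by
  have h : tilde δ t = 1 / t := if_pos (htν.trans hν)
  rw [h]
  refine Real.log_le_log (one_div_pos.2 (ht.trans_le htν)) (le_max_of_le_right ?_)
  exact one_div_le_one_div_of_le ht htν

theorem bump_eq_exp (hδ : 0 < δ) (x : M) (t : Ioi (0 : ℝ)) (ht : (t : ℝ) ≤ δ) (y : M) :
    bump (Cone.mk δ x t) y = Real.exp (logBump (tilde δ t) x y) := by
  rw [bump_mk hδ x t ht, exp_logBump]

theorem log_bump_div (hδ : 0 < δ) {x₁ x₂ : M} {t₁ t₂ : Ioi (0 : ℝ)} (ht₁ : (t₁ : ℝ) ≤ δ)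
    (ht₂ : (t₂ : ℝ) ≤ δ) (y : M) :
    Real.log (bump (Cone.mk δ x₂ t₂) y / bump (Cone.mk δ x₁ t₁) y ^ 2) =
      logBump (tilde δ t₂) x₂ y + -2 * logBump (tilde δ t₁) x₁ y := by
  rw [bump_eq_exp hδ x₁ t₁ ht₁, bump_eq_exp hδ x₂ t₂ ht₂,
    Real.log_div (Real.exp_pos _).ne' (by positivity), Real.log_pow, Real.log_exp, Real.log_exp]
  push_cast
  ring

/-- The test functions of a point of the parameter set, in terms of representatives. -/
theorem exists_representatives (hδ : 0 < δ) {ν : ℝ} {p : Cone M δ × Cone M δ}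
    (hp : p ∈ Xν M δ ν) :
    ∃ (x₁ x₂ : M) (t₁ t₂ : ℝ), 0 < t₁ ∧ 0 < t₂ ∧ t₁ ≤ δ ∧ t₂ ≤ δ ∧ min t₁ t₂ ≤ ν ∧
      (δ ^ 4 ≤ |t₁ - t₂| ^ 2 + dist x₁ x₂ ^ 2 ∨ max t₁ t₂ = δ) ∧
      φ₁ p = (fun y ↦ logBump (tilde δ t₂) x₂ y + -2 * logBump (tilde δ t₁) x₁ y) ∧
      φ₂ p = fun y ↦ logBump (tilde δ t₁) x₁ y + -2 * logBump (tilde δ t₂) x₂ y := by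
  rcases hp with ⟨-, x₁, x₂, t₁, t₂, rfl, hd, hmax, hmin⟩ | ⟨-, x₁, x₂, t₁, t₂, rfl, hmax, hmin⟩
  · have h1 := (le_max_left _ _).trans hmax.le
    have h2 := (le_max_right _ _).trans hmax.le
    exact ⟨x₁, x₂, t₁, t₂, t₁.2, t₂.2, h1, h2, hmin.2, Or.inl hd,
      funext fun y ↦ log_bump_div hδ h1 h2 y, funext fun y ↦ log_bump_div hδ h2 h1 y⟩
  · have h1 := (le_max_left _ _).trans hmax.le
    have h2 := (le_max_right _ _).trans hmax.le
    exact ⟨x₁, x₂, t₁, t₂, t₁.2, t₂.2, h1, h2, hmin.2, Or.inr hmax,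
      funext fun y ↦ log_bump_div hδ h1 h2 y, funext fun y ↦ log_bump_div hδ h2 h1 y⟩

theorem tilde_vertex (hδ : 0 < δ) : tilde δ δ = 0 := by
  have h : ¬ δ ≤ δ / 2 := by linarith
  simp [tilde, h]

/-- The bubbles of a point of the parameter set do not collide: one of them is spread out, or
they sit at a distance from each other. -/
theorem separated (hδ : 0 < δ) {x₁ x₂ : M} {t₁ t₂ : ℝ}
    (ht₁ : 0 < t₁) (ht₂ : 0 < t₂)
    (h : δ ^ 4 ≤ |t₁ - t₂| ^ 2 + dist x₁ x₂ ^ 2 ∨ max t₁ t₂ = δ) :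
    tilde δ t₁ ≤ 2 / δ ^ 2 + 2 / δ ∨ tilde δ t₂ ≤ 2 / δ ^ 2 + 2 / δ ∨
      δ ^ 2 / 2 ≤ dist x₁ x₂ := by
  rcases h with h | h
  · by_cases h1 : δ ^ 2 / 2 ≤ t₁
    · exact Or.inl (tilde_le hδ h1)
    by_cases h2 : δ ^ 2 / 2 ≤ t₂
    · exact Or.inr (Or.inl (tilde_le hδ h2))
    -- Both parameters are below δ²/2, so their difference uses at most δ⁴/4 of the separation δ⁴,
    -- leaving d² ≥ 3δ⁴/4.
    refine Or.inr (Or.inr ?_)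
    push Not at h1 h2
    have h3 : |t₁ - t₂| ≤ δ ^ 2 / 2 := by
      rw [abs_le]
      constructor <;> linarith
    have h4 : |t₁ - t₂| ^ 2 ≤ (δ ^ 2 / 2) ^ 2 := by gcongr
    refine le_of_sq_le_sq ?_ dist_nonneg
    nlinarith [sq_nonneg (δ ^ 2)]
  · have h0 : 0 ≤ 2 / δ ^ 2 + 2 / δ := by positivity
    rcases max_choice t₁ t₂ with hm | hm
    · rw [hm] at h
      exact Or.inl (by rw [h, tilde_vertex hδ]; exact h0)
    · rw [hm] at h
      exact Or.inr (Or.inl (by rw [h, tilde_vertex hδ]; exact h0))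

end Parameters

end Toda

end

/-! ### Conclusion: uniform divergence on the parameter set. -/

theorem lemma4p3 {M : Type*} [MetricSpace M] [CompactSpace M] [ChartedSpace Toda.Plane M]
    [IsManifold (𝓡 2) ∞ M]
    [RiemannianBundle (fun x : M ↦ TangentSpace (𝓡 2) x)]
    [IsContMDiffRiemannianBundle (𝓡 2) ∞ Toda.Plane (fun x : M ↦ TangentSpace (𝓡 2) x)]
    [IsRiemannianManifold (𝓡 2) M] [MeasurableSpace M] [BorelSpace M]
    (hvol : Toda.riemVolume M Set.univ = 1)
    (h₁ h₂ : M → ℝ) (hh₁ : ContMDiff (𝓡 2) 𝓘(ℝ, ℝ) 1 h₁) (hh₂ : ContMDiff (𝓡 2) 𝓘(ℝ, ℝ) 1 h₂)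
    (hpos₁ : ∀ x, 0 < h₁ x) (hpos₂ : ∀ x, 0 < h₂ x)
    (ρ₁ ρ₂ : ℝ) (hρ₁ : 4 * Real.pi < ρ₁) (hρ₂ : 4 * Real.pi < ρ₂)
    (δ : ℝ) (hδ : 0 < δ) :
    (∀ ν : ℝ, 0 < ν → ∀ p ∈ Toda.Xν M δ ν,
      Toda.MemH1 (Toda.φ₁ p) ∧ Toda.MemH1 (Toda.φ₂ p)) ∧
    ∀ L : ℝ, ∃ ν₀ > 0, ∀ ν : ℝ, 0 < ν → ν < ν₀ → ∀ p ∈ Toda.Xν M δ ν,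
      Toda.J ρ₁ ρ₂ h₁ h₂ (Toda.φ₁ p) (Toda.φ₂ p) ≤ -L := by
  have hprob : IsProbabilityMeasure (Toda.riemVolume M) := ⟨hvol⟩
  refine ⟨fun ν _ p hp ↦ ?_, fun L ↦ ?_⟩
  · obtain ⟨x₁, x₂, t₁, t₂, ht₁, ht₂, hδ₁, hδ₂, -, -, h1, h2⟩ :=
      Toda.exists_representatives hδ hp
    have n₁ := Toda.tilde_nonneg hδ ht₁ hδ₁
    have n₂ := Toda.tilde_nonneg hδ ht₂ hδ₂
    rw [h1, h2]
    exact ⟨Toda.memH1_combination n₁ n₂ x₁ x₂, Toda.memH1_combination n₂ n₁ x₂ x₁⟩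
  · obtain ⟨a, ha, C, hJ⟩ := Toda.exists_J_le hh₁.continuous hh₂.continuous hpos₁ hpos₂ hρ₁ hρ₂
      (C₀ := 2 / δ ^ 2 + 2 / δ) (c₀ := δ ^ 2 / 2) (by positivity) (by positivity)
    -- The first bound puts the smaller parameter on the branch 1/t; the second gives a log(1/ν) ≥ C
    -- + L.
    refine ⟨min (δ / 2) (Real.exp (-((C + L) / a))), by positivity, fun ν hν hνν₀ p hp ↦ ?_⟩
    obtain ⟨x₁, x₂, t₁, t₂, ht₁, ht₂, hδ₁, hδ₂, hmin, hsep, h1, h2⟩ :=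
      Toda.exists_representatives hδ hp
    have hνδ := hνν₀.le.trans (min_le_left _ _)
    have hlog : (C + L) / a ≤ Real.log (1 / ν) := by
      have h := Real.log_le_log hν (hνν₀.le.trans (min_le_right _ _))
      rw [Real.log_exp] at h
      rw [one_div, Real.log_inv]
      linarith
    have hT : ∀ t, 0 ≤ Real.log (max 1 (Toda.tilde δ t)) := fun t ↦
      Real.log_nonneg (le_max_left _ _)
    have hsum : (C + L) / a ≤ Real.log (max 1 (Toda.tilde δ t₁)) +
        Real.log (max 1 (Toda.tilde δ t₂)) := by
      rcases min_choice t₁ t₂ with h | h <;> rw [h] at hmin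
      · linarith [Toda.le_log_tilde ht₁ hmin hνδ, hT t₂]
      · linarith [Toda.le_log_tilde ht₂ hmin hνδ, hT t₁]
    rw [div_le_iff₀ ha] at hsum
    rw [h1, h2]
    refine (hJ _ _ (Toda.tilde_nonneg hδ ht₁ hδ₁) (Toda.tilde_nonneg hδ ht₂ hδ₂) x₁ x₂
      (Toda.separated hδ ht₁ ht₂ hsep)).trans ?_
    linarith
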